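/- All graphs are finite, simple and without isolated vertices. Let $G$ be a graph with vertex set $[n]$. For a field $K$ let $S=K[x_1,\dots,x_n]$ and let $I(G)\subset S$ be the edge ideal, generated by the monomials $x_ix_j$ with $\{i,j\}\in E(G)$. The graph $G$ is Cohen–Macaulay over $K$ if $S/I(G)$ is a Cohen–Macaulay ring. In that case $G$ is of type $r$ over $K$ if $r$ is the Cohen–Macaulay type of $S/I(G)$, i.e. $r=\dim_K\operatorname{Ext}^d_{S/I(G)}(K,\,S/I(G))$, where $d$ is the depth of the ideal $\mathfrak m=(x_1,\dots,x_n)$ on $S/I(G)$ and $K=S/\mathfrak m$; and $G$ is Gorenstein over $K$ if $G$ is Cohen–Macaulay over $K$ of type $1$. The graph $G$ is Cohen–Macaulay, of type $r$, or Gorenstein if it has that property over every field. Let $G$ be chordal, i.e. every cycle of length greater than $3$ has a chord. Let $F_1,\dots,F_m$ be those facets of the clique complex of $G$ (the maximal cliques of $G$) that have a free vertex, i.e. a vertex lying in no other facet. Choose a free vertex $i_j$ of $F_j$ for each $j=1,\dots,m$, and let $G'$ be the subgraph of $G$ induced on $[n]\setminus\{i_1,\dots,i_m\}$. Let $N$ be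 the number of independent sets of $G'$ that are maximal with respect to inclusion (the empty set counts if $G'$ has no vertices). Then: (a) For every field $K$ over which $G$ is Cohen–Macaulay, $G$ is of type $N$ over $K$. In particular, if $G$ is Cohen–Macaulay, then $G$ is of type $N$. (b) $G$ is Gorenstein if and only if $G$ is a disjoint union of edges, i.e. every vertex lies in exactly one edge. Moreover, for every field $K$, $G$ is Gorenstein over $K$ if and only if $G$ is a disjoint union of edges. -/

import Mathlib

open CategoryTheory

universe u w

noncomputable section

section Algebra

variable {R : Type u} [CommRing R]

/-- The depth (grade) of the ideal `I` on `R`: the supremum of the lengths of the `R`-regular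
sequences with all entries in `I`. For a local ring and its maximal ideal this is `depth R`. -/
def idealDepth (I : Ideal R) : ℕ∞ :=
  ⨆ (rs : List R) (_ : (∀ r ∈ rs, r ∈ I) ∧ RingTheory.Sequence.IsRegular R rs),
    (rs.length : ℕ∞)

/-- A Noetherian local ring is Cohen-Macaulay if its depth equals its Krull dimension. -/
def IsCohenMacaulayLocal (A : Type u) [CommRing A] [IsLocalRing A] : Prop :=
  IsNoetherianRing A ∧
    ((idealDepth (IsLocalRing.maximalIdeal A) : ℕ∞) : WithBot ℕ∞) = ringKrullDim A

/-- A Noetherian ring is Cohen-Macaulay if its localizations at all maximal ideals are. -/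
def IsCohenMacaulayRing (A : Type u) [CommRing A] : Prop :=
  IsNoetherianRing A ∧
    ∀ (n : Ideal A) [n.IsMaximal], IsCohenMacaulayLocal (Localization.AtPrime n)

/-- The Cohen-Macaulay type of `R` at the maximal ideal `m`: the dimension over `k = R ⧸ m` of
`Ext_R^t(k, R)`, where `t` is the depth of `m` on `R`. As this `Ext` module is annihilated by `m`,
its dimension over `k` is its length as an `R`-module. -/
def cohenMacaulayType (m : Ideal R) : ℕ∞ :=
  Module.length R
    (Abelian.Ext (ModuleCat.of R (R ⧸ m)) (ModuleCat.of R R) (idealDepth m).toNat)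

end Algebra

namespace SimpleGraph

variable {V : Type u}

/-- The edge ideal: generated by the `x_i x_j` with `{i, j}` an edge. -/
def edgeIdeal (K : Type w) [Field K] (G : SimpleGraph V) : Ideal (MvPolynomial V K) :=
  Ideal.span {f | ∃ i j, G.Adj i j ∧ f = MvPolynomial.X i * MvPolynomial.X j}

/-- The residue class ring `S/I(G)`. -/
abbrev EdgeRing (K : Type w) [Field K] (G : SimpleGraph V) : Type (max u w) :=
  MvPolynomial V K ⧸ edgeIdeal K G

/-- The graded maximal ideal of `S/I(G)`, generated by the residue classes of the variables. -/
def edgeRingIrrelevant (K : Type w) [Field K] (G : SimpleGraph V) : Ideal (EdgeRing K G) :=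
  Ideal.span (Set.range fun i : V => Ideal.Quotient.mk (edgeIdeal K G) (MvPolynomial.X i))

/-- `G` is Cohen-Macaulay over `K`. -/
def IsCohenMacaulayOver (K : Type w) [Field K] (G : SimpleGraph V) : Prop :=
  IsCohenMacaulayRing (EdgeRing K G)

/-- `G` is of type `r` over `K`: it is Cohen-Macaulay over `K` and the graded `K`-algebra `S/I(G)`
has Cohen-Macaulay type `r`. -/
def IsOfTypeOver (K : Type w) [Field K] (G : SimpleGraph V) (r : ℕ) : Prop :=
  IsCohenMacaulayOver K G ∧ cohenMacaulayType (edgeRingIrrelevant K G) = r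

/-- `G` is Gorenstein over `K`: `S/I(G)` is Cohen-Macaulay of type `1`. -/
def IsGorensteinOver (K : Type w) [Field K] (G : SimpleGraph V) : Prop :=
  IsOfTypeOver K G 1

/-- `G` is Cohen-Macaulay: it is so over every field. -/
def IsCohenMacaulay (G : SimpleGraph V) : Prop :=
  ∀ (K : Type w) [Field K], IsCohenMacaulayOver K G

/-- `G` is of type `r`: it is so over every field. -/
def IsOfType (G : SimpleGraph V) (r : ℕ) : Prop :=
  ∀ (K : Type w) [Field K], IsOfTypeOver K G r

/-- `G` is Gorenstein: it is so over every field. -/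
def IsGorenstein (G : SimpleGraph V) : Prop :=
  ∀ (K : Type w) [Field K], IsGorensteinOver K G

/-- Every cycle of length greater than `3` has a chord. -/
def IsChordal (G : SimpleGraph V) : Prop :=
  ∀ (v : V) (p : G.Walk v v), p.IsCycle → 3 < p.length → ∃ e, p.IsChord e

/-- The facets of the clique complex of `G`: the maximal cliques. -/
def IsCliqueFacet (G : SimpleGraph V) (F : Set V) : Prop :=
  Maximal G.IsClique F

/-- `v` is a free vertex of the facet `F`: it lies in `F` and in no other facet. -/
def IsFreeVertex (G : SimpleGraph V) (F : Set V) (v : V) : Prop :=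
  v ∈ F ∧ ∀ H, G.IsCliqueFacet H → v ∈ H → H = F

/-- The set of facets of the clique complex of `G` that have a free vertex. -/
def freeFacets (G : SimpleGraph V) : Set (Set V) :=
  {F | G.IsCliqueFacet F ∧ ∃ v, G.IsFreeVertex F v}

/-- The number of maximal (with respect to inclusion) independent sets of `G`. -/
def numMaximalIndepSets (G : SimpleGraph V) : ℕ :=
  {s : Set V | Maximal G.IsIndepSet s}.ncard

/-- `G` is a disjoint union of edges: every vertex lies in exactly one edge. -/
def IsDisjointUnionOfEdges (G : SimpleGraph V) : Prop :=
  ∀ v, ∃! e, e ∈ G.edgeSet ∧ v ∈ e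

end SimpleGraph

end

/-!
Write `S/I(G)` for the edge ring and call `G` well-covered if all its maximal independent sets have
the same size.

If `S/I(G)` is Cohen-Macaulay, then `G` is well-covered: a maximal independent set `s` gives an
associated prime of `S/I(G)`, generated by the variables outside `s`, with residue ring of dimension
`|s|`. The length of a regular sequence in the localization at the irrelevant ideal is bounded by
this dimension (`RingTheory.Sequence.IsRegular.length_le_ringKrullDim_quotient`), while the
dimension of the localization is at least the size of every independent set
(`SimpleGraph.IsCohenMacaulayOver.card_le_card`).

If `G` is moreover chordal, then the facets with a free vertex partition the vertices. They are
disjoint since a common vertex of two of them could be exchanged for the two free vertices in a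
maximal independent set. They cover: `G` has a cover by as many cliques as some independent set has
elements, so every clique of the cover meets every maximal independent set; and a clique `Q` without
a free vertex would be dominated by an independent set outside `Q`, picked from the components of
`G - Q` (`SimpleGraph.IsChordal.exists_mem_freeFacets`).

Given such a partition `F_1, ..., F_m` with free vertices `i_j`, let `θ_j` be the sum of the
variables in `F_j`. Eliminating the variable of `i_j` by means of `θ_j` turns the relations of
`S/I(G)` into `x_v ^ 2 = θ_j x_v` for `v` in `F_j` together with the edge relations of the remaining
graph `G'`. Hence `S/I(G)` is free over `K[θ_1, ..., θ_m]` on the squarefree monomials supported on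
the independent sets of `G'`; linear independence is checked by restricting to the maximal
independent sets of `G`. So `θ` is a regular sequence, dimension shifting identifies the Ext module
defining the type with the socle of `S/(I(G), θ)`, and the monomials of the maximal independent sets
of `G'` form a basis of that socle (`SimpleGraph.FreeCliquePartition.cohenMacaulayType_eq`).
Freeness over a polynomial ring also gives the Cohen-Macaulay property at all maximal ideals, which
the converse direction of the Gorenstein criterion needs.

The number of maximal independent sets of `G'` is `1` exactly if `G'` has no edges, and without
isolated vertices this means that all the `F_j` are edges and `G` has no other edges.
-/

/-! ### Regular sequences and dimension shifting for Ext -/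

section

open Abelian RingTheory.Sequence Module
open scoped Pointwise

/-- Polynomials `f i (X i)`, each monic in its own variable, form a weakly regular sequence. -/
theorem MvPolynomial.isWeaklyRegular_aeval_X_of_monic {k : Type*} [CommRing k] {n : ℕ}
    (f : Fin n → Polynomial k) (hf : ∀ i, (f i).Monic) :
    IsWeaklyRegular (MvPolynomial (Fin n) k)
      (List.ofFn fun i => Polynomial.aeval (MvPolynomial.X i : MvPolynomial (Fin n) k)
        (f i)).reverse := by
  induction n with
  | zero => simp
  | succ n ih =>
    let B := MvPolynomial (Fin n) k
    let rs : List B := (List.ofFn fun i : Fin n =>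
      Polynomial.aeval (MvPolynomial.X i : B) (f i.succ)).reverse
    have hrs : IsWeaklyRegular B rs := ih _ fun i => hf _
    let g : Polynomial B := (f 0).map (algebraMap k B)
    have hg : g.Monic := (hf 0).map _
    have key : IsWeaklyRegular (Polynomial B)
        (rs.map (algebraMap B (Polynomial B)) ++ [g]) := by
      rw [isWeaklyRegular_append_iff]
      refine ⟨hrs.of_flat, ?_⟩
      rw [isWeaklyRegular_singleton_iff, isSMulRegular_iff_right_eq_zero_of_smul]
      intro x hx
      obtain ⟨p, rfl⟩ := Submodule.Quotient.mk_surjective _ x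
      rw [← Submodule.Quotient.mk_smul, Submodule.Quotient.mk_eq_zero, ← Ideal.map_ofList,
        smul_eq_mul, Ideal.mul_top] at hx
      rw [Submodule.Quotient.mk_eq_zero, ← Ideal.map_ofList, smul_eq_mul, Ideal.mul_top]
      change _ ∈ Ideal.map Polynomial.C _ at hx
      change _ ∈ Ideal.map Polynomial.C _
      have hker : ∀ q : Polynomial B, q ∈ Ideal.map Polynomial.C (Ideal.ofList rs) ↔
          q.map (Ideal.Quotient.mk (Ideal.ofList rs)) = 0 := by
        intro q
        rw [Ideal.mem_map_C_iff, Polynomial.ext_iff]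
        simp [Ideal.Quotient.eq_zero_iff_mem]
      rw [hker] at hx ⊢
      rw [smul_eq_mul, Polynomial.map_mul] at hx
      exact ((hg.map _).mul_right_eq_zero_iff).1 hx
    let e := (MvPolynomial.finSuccEquiv k n).symm
    have := (AddEquiv.isWeaklyRegular_congr (e := e.toRingEquiv.toAddEquiv)
      (as := rs.map (algebraMap B (Polynomial B)) ++ [g])
      (bs := (rs.map (algebraMap B (Polynomial B)) ++ [g]).map e)
      (by
        rw [List.forall₂_map_right_iff, List.forall₂_same]
        intro r _ x
        simp [e])).1 key
    convert this using 1
    have h1 : ∀ i : Fin n, e (Polynomial.C (MvPolynomial.X i)) = MvPolynomial.X i.succ := by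
      intro i
      rw [AlgEquiv.symm_apply_eq, MvPolynomial.finSuccEquiv_X_succ]
    have h2 : e g = Polynomial.aeval (MvPolynomial.X 0) (f 0) := by
      rw [AlgEquiv.symm_apply_eq, ← Polynomial.aeval_algHom_apply,
        MvPolynomial.finSuccEquiv_X_zero, ← Polynomial.aeval_map_algebraMap B,
        Polynomial.aeval_X_left_apply]
    simp only [List.ofFn_succ, List.reverse_cons, rs, List.map_append, List.map_reverse,
      List.map_ofFn, List.map_cons, List.map_nil, h2]
    congr 3
    funext i
    simp only [Function.comp]
    rw [← h1, ← Polynomial.algebraMap_eq, Polynomial.aeval_algHom_apply,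
      Polynomial.aeval_algebraMap_apply]

/-- Dimension shifting along an `M`-regular sequence in the annihilator of `N`: in each step the
connecting map is injective by the vanishing part of the Rees theorem, and surjective because the
element of the sequence acts on `Ext` as zero. -/
theorem exists_ext_linearEquiv_of_isRegular {R : Type u} [CommRing R] [IsNoetherianRing R]
    (N : ModuleCat.{u} R) [Module.Finite R N] (I : Ideal R) (hI : I = annihilator R N)
    (rs : List R) (mem : ∀ r ∈ rs, r ∈ I) (M : ModuleCat.{u} R) [Module.Finite R M]
    (hM : I • (⊤ : Submodule R M) < ⊤) (reg : IsRegular M rs) :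
    Nonempty (Ext N M rs.length ≃ₗ[R]
      (N →ₗ[R] (M ⧸ (Ideal.ofList rs • ⊤ : Submodule R M)))) := by
  induction rs generalizing M with
  | nil =>
    refine ⟨(Ext.linearEquiv₀ (R := R)).trans (ModuleCat.homLinearEquiv.trans
      (LinearEquiv.congrRight (Submodule.quotEquivOfEqBot _ ?_).symm))⟩
    rw [Ideal.ofList_nil, Submodule.bot_smul]
  | cons a rs ih =>
    have hsub := ModuleCat.subsingleton_ext_of_exists_isRegular I N
      (by rw [hI, support_eq_zeroLocus]) M hM (a :: rs) mem reg rs.length (by simp)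
    rw [isRegular_cons_iff] at reg
    simp only [List.mem_cons, forall_eq_or_imp] at mem
    let M' := ModuleCat.of R (QuotSMulTop a M)
    have hM' : I • (⊤ : Submodule R M') < ⊤ := by
      refine lt_top_iff_ne_top.2 fun h => hM.ne ?_
      have := congrArg (Submodule.comap (Submodule.mkQ (a • (⊤ : Submodule R M)))) h
      simpa [M', Submodule.comap_smul_top_of_surjective I _ (Submodule.mkQ_surjective _),
        Submodule.smul_mono_left ((Ideal.span_singleton_le_iff_mem I).mpr mem.1),
        ← Submodule.ideal_span_singleton_smul] using this
    obtain ⟨e⟩ := ih mem.2 M' hM' reg.2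
    have hS := reg.1.smulShortComplex_shortExact
    let δ : Ext N M' rs.length →ₗ[R] Ext N M (rs.length + 1) :=
      { toFun := fun x => x.comp hS.extClass rfl
        map_add' := fun x y => Ext.add_comp x y _ _
        map_smul' := fun r x => Ext.smul_comp x _ _ r }
    have hδ : Function.Bijective δ := by
      constructor
      · rw [← LinearMap.ker_eq_bot, LinearMap.ker_eq_bot']
        intro x hx
        obtain ⟨y, rfl⟩ := Ext.covariant_sequence_exact₃ N hS x rfl hx
        have : y = 0 := hsub.elim _ _
        subst this
        exact Ext.zero_comp N _ (Ext.mk₀ (M.smulShortComplex a).g) _ (add_zero _)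
      · intro y
        refine Ext.covariant_sequence_exact₁ N hS y ?_ rfl
        have := Ext.postcomp_smul_id_eq_zero_of_mem_annihilator (M := M) (N := N)
          (hI ▸ mem.1) (rs.length + 1)
        exact congr($this y)
    exact ⟨(LinearEquiv.ofBijective δ hδ).symm.trans (e.trans (LinearEquiv.congrRight
      (Submodule.quotOfListConsSMulTopEquivQuotSMulTopInner M a rs).symm))⟩

/-- The length of a regular sequence is bounded by the dimension of `A ⧸ p` for every associated
prime `p`: modulo the first element `x` of the sequence there is an associated prime containing `p`
and `x`, and `x` is not in `p`. -/
theorem RingTheory.Sequence.IsRegular.length_le_ringKrullDim_quotient {A : Type*} [CommRing A]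
    [IsNoetherianRing A] [IsLocalRing A] {M : Type*} [AddCommGroup M] [Module A M]
    [Module.Finite A M] (rs : List A) (reg : IsRegular M rs) (p : Ideal A)
    (hp : p ∈ associatedPrimes A M) : (rs.length : WithBot ℕ∞) ≤ ringKrullDim (A ⧸ p) := by
  induction rs generalizing M p with
  | nil =>
    have := hp.isPrime
    simpa using ringKrullDim_nonneg_of_nontrivial
  | cons x rs ih =>
    have hxm : x ∈ IsLocalRing.maximalIdeal A := by
      rw [IsLocalRing.mem_maximalIdeal]
      intro hu
      refine reg.2 ?_
      rw [Ideal.ofList_cons, Ideal.span_singleton_eq_top.2 hu, top_sup_eq, Submodule.top_smul]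
    rw [isRegular_cons_iff] at reg
    obtain ⟨hprime, z, hz⟩ := isAssociatedPrime_iff.1 hp
    -- by Nakayama, the submodule of `M` killed by `p` is not contained in `xM`
    let U : Submodule A M := Submodule.torsionBySet A M p
    have hzU : z ∈ U := by
      rw [Submodule.mem_torsionBySet_iff]
      rintro ⟨a, ha⟩
      change a ∈ p at ha
      rw [hz, Submodule.mem_colon_singleton] at ha
      simpa using ha
    have hz0 : z ≠ 0 := by
      rintro rfl
      exact hprime.ne_top (by rw [hz]; ext; simp)
    have hU : ¬ U ≤ x • (⊤ : Submodule A M) := by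
      intro hle
      have hUx : U ≤ x • U := by
        intro y hy
        obtain ⟨y', -, rfl⟩ := (Submodule.mem_smul_pointwise_iff_exists _ _ _).1 (hle hy)
        refine Submodule.smul_mem_pointwise_smul _ _ _ ?_
        rw [Submodule.mem_torsionBySet_iff] at hy ⊢
        intro a
        have := hy a
        rw [smul_comm] at this
        exact reg.1.right_eq_zero_of_smul this
      have : U = ⊥ := by
        refine Submodule.eq_bot_of_le_smul_of_le_jacobson_bot (Ideal.span {x}) U
          (IsNoetherian.noetherian U) ?_ ?_
        · rwa [Submodule.ideal_span_singleton_smul]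
        · rw [IsLocalRing.jacobson_eq_maximalIdeal _ bot_ne_top, Ideal.span_singleton_le_iff_mem]
          exact hxm
      rw [this] at hzU
      exact hz0 hzU
    obtain ⟨y, hyU, hyx⟩ := Set.not_subset.1 hU
    have hy0 : (Submodule.Quotient.mk y : QuotSMulTop x M) ≠ 0 := by
      rwa [Ne, Submodule.Quotient.mk_eq_zero]
    obtain ⟨q, hq, hle⟩ := exists_le_isAssociatedPrime_of_isNoetherianRing A _ hy0
    have hqprime := hq.isPrime
    have hpq : p ≤ q := by
      intro a ha
      refine hle ?_
      rw [Submodule.mem_colon_singleton, ← Submodule.Quotient.mk_smul]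
      have : a • y = 0 := (Submodule.mem_torsionBySet_iff _ _).1 hyU ⟨a, ha⟩
      simp [this]
    have hxq : x ∈ q := by
      refine hle ?_
      rw [Submodule.mem_colon_singleton, ← Submodule.Quotient.mk_smul, Submodule.mem_bot,
        Submodule.Quotient.mk_eq_zero]
      exact Submodule.smul_mem_pointwise_smul _ _ _ trivial
    have hxp : x ∉ p := by
      intro h
      have h1 : x • z = 0 := (Submodule.mem_torsionBySet_iff _ _).1 hzU ⟨x, h⟩
      exact hz0 (reg.1.right_eq_zero_of_smul h1)
    have h1 := ih reg.2 q hq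
    have h2 : ringKrullDim (A ⧸ q) + 1 ≤ ringKrullDim (A ⧸ p) := by
      refine ringKrullDim_succ_le_of_surjective (Ideal.Quotient.factor hpq)
        (Ideal.Quotient.factor_surjective hpq) (r := Ideal.Quotient.mk p x) ?_ ?_
      · rw [mem_nonZeroDivisors_iff_ne_zero, Ne, Ideal.Quotient.eq_zero_iff_mem]
        exact hxp
      · simpa [Ideal.Quotient.eq_zero_iff_mem] using hxq
    calc ((x :: rs).length : WithBot ℕ∞) = (rs.length : WithBot ℕ∞) + 1 := by simp
      _ ≤ ringKrullDim (A ⧸ q) + 1 := by gcongr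
      _ ≤ _ := h2

end

/-! ### Depth, the Cohen-Macaulay property and the type -/

section

open Abelian RingTheory.Sequence Module
open scoped Pointwise

theorem idealDepth_le {R : Type u} [CommRing R] {I : Ideal R} {b : ℕ∞}
    (h : ∀ rs : List R, (∀ r ∈ rs, r ∈ I) → IsRegular R rs → (rs.length : ℕ∞) ≤ b) :
    idealDepth I ≤ b :=
  iSup₂_le fun rs hrs => h rs hrs.1 hrs.2

theorem length_le_idealDepth {R : Type u} [CommRing R] {I : Ideal R} {rs : List R}
    (mem : ∀ r ∈ rs, r ∈ I) (reg : IsRegular R rs) : (rs.length : ℕ∞) ≤ idealDepth I :=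
  le_iSup₂_of_le rs ⟨mem, reg⟩ le_rfl

/-- The sequence of `MvPolynomial.isWeaklyRegular_aeval_X_of_monic` for any finite set of
variables. -/
theorem MvPolynomial.exists_isWeaklyRegular_of_monic {k ι : Type*} [CommRing k] [Fintype ι]
    (f : ι → Polynomial k) (hf : ∀ i, (f i).Monic) :
    ∃ rs : List (MvPolynomial ι k), rs.length = Fintype.card ι ∧
      (∀ r, r ∈ rs ↔ ∃ i, Polynomial.aeval (MvPolynomial.X i : MvPolynomial ι k) (f i) = r) ∧
      IsWeaklyRegular (MvPolynomial ι k) rs := by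
  let e := Fintype.equivFin ι
  let φ := MvPolynomial.renameEquiv k e.symm
  have h := MvPolynomial.isWeaklyRegular_aeval_X_of_monic (fun i => f (e.symm i)) fun i => hf _
  set rs := (List.ofFn fun i => Polynomial.aeval
    (MvPolynomial.X i : MvPolynomial (Fin (Fintype.card ι)) k) (f (e.symm i))).reverse with hrs
  refine ⟨rs.map φ, by simp [rs], fun r => ?_,
    (AddEquiv.isWeaklyRegular_congr (e := φ.toRingEquiv.toAddEquiv) (as := rs)
      (bs := rs.map φ) (by
        rw [List.forall₂_map_right_iff, List.forall₂_same]
        intro r _ x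
        simp [φ])).1 h⟩
  have hφ : ∀ i, φ (Polynomial.aeval (MvPolynomial.X i) (f (e.symm i))) =
      Polynomial.aeval (MvPolynomial.X (e.symm i)) (f (e.symm i)) := by
    intro i
    rw [← Polynomial.aeval_algHom_apply]
    simp [φ]
  simp only [rs, List.map_reverse, List.mem_reverse, List.map_ofFn, List.mem_ofFn,
    Function.comp, hφ]
  exact (e.symm.surjective.exists
    (p := fun i => Polynomial.aeval (MvPolynomial.X i) (f i) = r)).symm

theorem ringKrullDim_le_of_isIntegral {A R : Type*} [CommRing A] [CommRing R] [Algebra A R]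
    [Algebra.IsIntegral A R] : ringKrullDim R ≤ ringKrullDim A :=
  Order.krullDim_le_of_strictMono (PrimeSpectrum.comap (algebraMap A R))
    fun _ _ h => Ideal.IsIntegral.comap_lt_comap h

/-- For a maximal ideal `N`, the minimal polynomials of the variables modulo the contraction of `N`
give a regular sequence in `N` whose length is the number of variables. -/
theorem isCohenMacaulayRing_of_finite_flat {K : Type*} [Field K] {ι : Type*} [Fintype ι] {R : Type u}
    [CommRing R] [Algebra (MvPolynomial ι K) R] [Module.Finite (MvPolynomial ι K) R]
    [Module.Flat (MvPolynomial ι K) R] : IsCohenMacaulayRing R := by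
  let A := MvPolynomial ι K
  have hR : IsNoetherianRing R := IsNoetherianRing.of_finite A R
  refine ⟨hR, fun N hN => ⟨inferInstance, ?_⟩⟩
  let L := Localization.AtPrime N
  let p : Ideal A := N.comap (algebraMap A R)
  have hp : p.IsMaximal := Ideal.isMaximal_comap_of_isIntegral_of_isMaximal N
  let := Ideal.Quotient.field p
  have hfin : Module.Finite K (A ⧸ p) := finite_of_finite_type_of_isJacobsonRing K (A ⧸ p)
  let f : ι → Polynomial K := fun i => minpoly K (Ideal.Quotient.mk p (MvPolynomial.X i))
  have hf : ∀ i, (f i).Monic := fun i => minpoly.monic (IsIntegral.of_finite K _)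
  obtain ⟨rs, hlen, hrsmem, hrs⟩ := MvPolynomial.exists_isWeaklyRegular_of_monic f hf
  have hmem : ∀ r ∈ rs, r ∈ p := by
    intro r hr
    obtain ⟨i, rfl⟩ := (hrsmem r).1 hr
    rw [← Ideal.Quotient.eq_zero_iff_mem]
    have := Polynomial.aeval_algHom_apply (Ideal.Quotient.mkₐ K p) (MvPolynomial.X i) (f i)
    exact this.symm.trans (minpoly.aeval K _)
  have hreg : IsRegular L ((rs.map (algebraMap A R)).map (algebraMap R L)) :=
    (hrs.of_flat (S := R)).isRegular_of_isLocalization_of_mem L N (by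
      intro r hr
      obtain ⟨a, ha, rfl⟩ := List.mem_map.1 hr
      exact hmem a ha)
  have hdim : ringKrullDim L ≤ Fintype.card ι := by
    rw [IsLocalization.AtPrime.ringKrullDim_eq_height N L]
    refine (Ideal.height_le_ringKrullDim_of_isPrime).trans
      ((ringKrullDim_le_of_isIntegral (A := A)).trans ?_)
    rw [MvPolynomial.ringKrullDim_of_isNoetherianRing, ringKrullDim_eq_zero_of_field]
    simp
  refine le_antisymm ?_ (hdim.trans ?_)
  · obtain ⟨d, hd⟩ : ∃ d : ℕ∞, ringKrullDim L = d := by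
      have := ringKrullDim_nonneg_of_nontrivial (R := L)
      exact ⟨(ringKrullDim L).unbot (by rintro h; simp [h] at this), by simp⟩
    rw [hd, WithBot.coe_le_coe]
    refine idealDepth_le fun xs _ hxs => ?_
    rw [← WithBot.coe_le_coe, ← hd, ← ringKrullDim_add_length_eq_ringKrullDim_of_isRegular xs hxs]
    have : Nontrivial (L ⧸ Ideal.ofList xs) := by
      refine Ideal.Quotient.nontrivial_iff.2 fun h => hxs.2 ?_
      rw [h, Submodule.top_smul]
    exact le_add_of_nonneg_left ringKrullDim_nonneg_of_nontrivial
  · have h := length_le_idealDepth (I := IsLocalRing.maximalIdeal L) (fun r hr => ?_) hreg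
    · have h2 : (Fintype.card ι : ℕ∞) ≤ idealDepth (IsLocalRing.maximalIdeal L) := by
        simpa [hlen] using h
      exact_mod_cast WithBot.coe_le_coe.2 h2
    · simp only [List.mem_map] at hr
      obtain ⟨_, ⟨a, ha, rfl⟩, rfl⟩ := hr
      exact (IsLocalization.AtPrime.to_map_mem_maximal_iff L N _).2 (hmem a ha)

/-- The length of `Hom(R/I, M)` for a maximal ideal `I` is the number of elements of a basis of the
socle of `M` over the field `R/I`; the basis is given through its coefficients in `R`. -/
theorem length_linearMap_quotient {R : Type*} [CommRing R] (I : Ideal R) [I.IsMaximal]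
    {M : Type*} [AddCommGroup M] [Module R M] {ι : Type*} [Fintype ι] (s : ι → M)
    (hs : ∀ i, ∀ a ∈ I, a • s i = 0) (hind : ∀ r : ι → R, ∑ i, r i • s i = 0 → ∀ i, r i ∈ I)
    (hspan : ∀ x : M, (∀ a ∈ I, a • x = 0) → ∃ r : ι → R, x = ∑ i, r i • s i) :
    Module.length R ((R ⧸ I) →ₗ[R] M) = Fintype.card ι := by
  classical
  let h : ι → ((R ⧸ I) →ₗ[R] M) := fun i => Submodule.liftQ I (LinearMap.toSpanSingleton R M (s i))
    fun a ha => by simpa using hs i a ha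
  let Φ : (ι → R) →ₗ[R] ((R ⧸ I) →ₗ[R] M) := Fintype.linearCombination R h
  have hΦ1 : ∀ r, Φ r (Ideal.Quotient.mk I 1) = ∑ i, r i • s i := by
    intro r
    simp only [Φ, Fintype.linearCombination_apply, LinearMap.sum_apply, LinearMap.smul_apply]
    refine Finset.sum_congr rfl fun i _ => ?_
    congr 1
    exact (Submodule.liftQ_apply _ _ _).trans (by simp)
  have hsurj : Function.Surjective Φ := by
    intro φ
    obtain ⟨r, hr⟩ := hspan (φ (Ideal.Quotient.mk I 1)) fun a ha => by
      rw [← map_smul]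
      have : a • (Ideal.Quotient.mk I 1) = 0 := by
        rw [Algebra.smul_def, map_one, mul_one]
        exact Ideal.Quotient.eq_zero_iff_mem.2 ha
      rw [this, map_zero]
    refine ⟨r, ?_⟩
    refine Submodule.linearMap_qext _ (LinearMap.ext_ring ?_)
    exact (hΦ1 r).trans hr.symm
  have hker : LinearMap.ker Φ = Submodule.pi Set.univ fun _ => I := by
    ext r
    rw [LinearMap.mem_ker, Submodule.mem_pi]
    constructor
    · intro h0 i _
      exact hind r (by rw [← hΦ1, h0, LinearMap.zero_apply]) i
    · intro hr
      refine Submodule.linearMap_qext _ (LinearMap.ext_ring ?_)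
      refine (hΦ1 r).trans ?_
      exact Finset.sum_eq_zero fun i _ => hs i _ (hr i trivial)
  let e := (Φ.quotKerEquivOfSurjective hsurj).symm.trans
    ((Submodule.quotEquivOfEq _ _ hker).trans (Submodule.quotientPi fun _ => I))
  have : IsSimpleModule R (R ⧸ I) := isSimpleModule_iff_isCoatom.2 (Ideal.isMaximal_def.1 ‹_›)
  rw [e.length_eq, Module.length_pi_of_fintype]
  simp

/-- The type is the dimension of the socle modulo a regular sequence, here given by a basis `s`. -/
theorem cohenMacaulayType_eq_card {R : Type u} [CommRing R] [IsNoetherianRing R] (m : Ideal R)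
    [m.IsMaximal] (rs : List R) (mem : ∀ r ∈ rs, r ∈ m) (reg : IsRegular R rs)
    {ι : Type*} [Fintype ι] [Nonempty ι] (s : ι → R)
    (hs : ∀ i, ∀ a ∈ m, a * s i ∈ Ideal.ofList rs)
    (hind : ∀ r : ι → R, ∑ i, r i * s i ∈ Ideal.ofList rs → ∀ i, r i ∈ m)
    (hspan : ∀ x, (∀ a ∈ m, a * x ∈ Ideal.ofList rs) →
      ∃ r : ι → R, x - ∑ i, r i * s i ∈ Ideal.ofList rs) :
    cohenMacaulayType m = Fintype.card ι := by
  let k := ModuleCat.of R (R ⧸ m)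
  let M := ModuleCat.of R R
  have hM : m • (⊤ : Submodule R M) < ⊤ := by
    rw [lt_top_iff_ne_top]
    change m • (⊤ : Ideal R) ≠ ⊤
    rw [smul_eq_mul, Ideal.mul_top]
    exact Ideal.IsPrime.ne_top'
  have hann : m = annihilator R k := (Ideal.annihilator_quotient).symm
  obtain ⟨e⟩ := exists_ext_linearEquiv_of_isRegular k m hann rs mem M hM reg
  let J : Ideal R := Ideal.ofList rs
  have hlen : Module.length R (Ext k M rs.length) = Fintype.card ι := by
    have hJ : (Ideal.ofList rs • ⊤ : Submodule R M) = J := Ideal.mul_top _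
    rw [(e.trans (LinearEquiv.congrRight (Submodule.quotEquivOfEq _ _ hJ))).length_eq]
    refine length_linearMap_quotient m (fun i => (Submodule.Quotient.mk (s i) : R ⧸ J)) ?_ ?_ ?_
    · intro i a ha
      rw [← Submodule.Quotient.mk_smul, Submodule.Quotient.mk_eq_zero]
      exact hs i a ha
    · intro r hr
      refine hind r ?_
      rw [← Submodule.Quotient.mk_eq_zero, ← Submodule.mkQ_apply, map_sum]
      exact hr
    · intro x
      obtain ⟨x, rfl⟩ := Submodule.Quotient.mk_surjective _ x
      intro hx
      obtain ⟨r, hr⟩ := hspan x fun a ha => by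
        have := hx a ha
        rwa [← Submodule.Quotient.mk_smul, Submodule.Quotient.mk_eq_zero] at this
      refine ⟨r, ?_⟩
      rw [← sub_eq_zero]
      rw [← Submodule.Quotient.mk_eq_zero, ← Submodule.mkQ_apply, map_sub, map_sum] at hr
      exact hr
  have hdepth : idealDepth m = rs.length := by
    refine le_antisymm (idealDepth_le fun xs hxs hreg => ?_) (length_le_idealDepth mem reg)
    by_contra! hlt
    have := ModuleCat.subsingleton_ext_of_exists_isRegular m k
      (by rw [hann, support_eq_zeroLocus]) M hM xs hxs hreg rs.length (by exact_mod_cast hlt)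
    rw [Module.length_eq_zero] at hlen
    exact Fintype.card_ne_zero (by exact_mod_cast hlen.symm)
  rw [cohenMacaulayType, hdepth]
  exact hlen

end

/-! ### The edge ring over the clique sums -/

section

open RingTheory.Sequence Module

namespace SimpleGraph

section EdgeRing

variable {V : Type u} (K : Type w) [Field K] (G : SimpleGraph V)

/-- The residue class of a variable in `S/I(G)`. -/
noncomputable def edgeRingX (v : V) : EdgeRing K G :=
  Ideal.Quotient.mk (edgeIdeal K G) (MvPolynomial.X v)

variable {K G}

theorem edgeRingX_mul_edgeRingX {v w : V} (h : G.Adj v w) :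
    edgeRingX K G v * edgeRingX K G w = 0 := by
  rw [edgeRingX, edgeRingX, ← map_mul, Ideal.Quotient.eq_zero_iff_mem]
  exact Ideal.subset_span ⟨v, w, h, rfl⟩

theorem edgeRingX_mem_irrelevant (v : V) : edgeRingX K G v ∈ edgeRingIrrelevant K G :=
  Ideal.subset_span ⟨v, rfl⟩

theorem edgeRing_induction {P : EdgeRing K G → Prop} (hC : ∀ a : K, P (algebraMap K _ a))
    (hadd : ∀ r s, P r → P s → P (r + s)) (hX : ∀ r v, P r → P (r * edgeRingX K G v))
    (r : EdgeRing K G) : P r := by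
  obtain ⟨p, rfl⟩ := Ideal.Quotient.mk_surjective r
  induction p using MvPolynomial.induction_on with
  | C a => exact hC a
  | add p q hp hq => rw [map_add]; exact hadd _ _ hp hq
  | mul_X p v hp => rw [map_mul]; exact hX _ _ hp

variable (K G) in
/-- The `K`-algebra homomorphism out of `S/I(G)` determined by the images of the variables. -/
noncomputable def edgeRingLift {B : Type*} [CommRing B] [Algebra K B] (y : V → B)
    (hy : ∀ v w, G.Adj v w → y v * y w = 0) : EdgeRing K G →ₐ[K] B :=
  Ideal.Quotient.liftₐ (edgeIdeal K G) (MvPolynomial.aeval y) (by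
    intro a ha
    rw [← RingHom.mem_ker]
    revert a
    change edgeIdeal K G ≤ _
    rw [edgeIdeal, Ideal.span_le]
    rintro _ ⟨i, j, hij, rfl⟩
    simpa using hy i j hij)

@[simp]
theorem edgeRingLift_edgeRingX {B : Type*} [CommRing B] [Algebra K B] (y : V → B)
    (hy : ∀ v w, G.Adj v w → y v * y w = 0) (v : V) :
    edgeRingLift K G y hy (edgeRingX K G v) = y v := by
  change MvPolynomial.aeval y (MvPolynomial.X v) = _
  simp

theorem exists_sub_algebraMap_mem_irrelevant (r : EdgeRing K G) :
    ∃ a : K, r - algebraMap K _ a ∈ edgeRingIrrelevant K G := by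
  induction r using edgeRing_induction with
  | hC a => exact ⟨a, by simp⟩
  | hadd r s hr hs =>
    obtain ⟨a, ha⟩ := hr
    obtain ⟨b, hb⟩ := hs
    refine ⟨a + b, ?_⟩
    convert add_mem ha hb using 1
    rw [map_add]; ring
  | hX r v hr =>
    exact ⟨0, by simpa using Ideal.mul_mem_left _ _ (edgeRingX_mem_irrelevant v)⟩

variable (K G) in
/-- Evaluation at the origin. -/
noncomputable def edgeRingEval : EdgeRing K G →ₐ[K] K :=
  edgeRingLift K G (fun _ => 0) (by simp)

theorem ker_edgeRingEval : RingHom.ker (edgeRingEval K G) = edgeRingIrrelevant K G := by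
  have hle : edgeRingIrrelevant K G ≤ RingHom.ker (edgeRingEval K G) := by
    rw [edgeRingIrrelevant, Ideal.span_le]
    rintro _ ⟨v, rfl⟩
    exact edgeRingLift_edgeRingX _ _ v
  refine le_antisymm (fun r hr => ?_) hle
  obtain ⟨a, ha⟩ := exists_sub_algebraMap_mem_irrelevant r
  have h := hle ha
  rw [RingHom.mem_ker] at h hr
  rw [map_sub, hr, AlgHom.commutes, zero_sub, neg_eq_zero] at h
  have : a = 0 := h
  simpa [this] using ha

instance isMaximal_edgeRingIrrelevant : (edgeRingIrrelevant K G).IsMaximal := by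
  rw [← ker_edgeRingEval]
  exact RingHom.ker_isMaximal_of_surjective _ fun a => ⟨algebraMap K _ a, by simp⟩

instance [Finite V] : IsNoetherianRing (EdgeRing K G) :=
  inferInstanceAs (IsNoetherianRing (MvPolynomial V K ⧸ edgeIdeal K G))

end EdgeRing

/-- A partition of the vertices into cliques, indexed by `ι`, each clique coming with a vertex
all of whose neighbours lie in the clique. -/
structure FreeCliquePartition {V : Type u} (G : SimpleGraph V) (ι : Type*) where
  /-- the index of the clique containing a vertex -/
  part : V → ι
  /-- the chosen vertex of each clique -/
  free : ι → V
  part_free : ∀ j, part (free j) = j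
  adj_of_part_eq : ∀ {v w}, v ≠ w → part v = part w → G.Adj v w
  part_eq_of_adj : ∀ {j w}, G.Adj (free j) w → part w = j

namespace FreeCliquePartition

variable {V : Type u} {G : SimpleGraph V} {ι : Type*} (P : G.FreeCliquePartition ι)
  (K : Type w) [Field K]

/-- The vertices different from the chosen ones. -/
abbrev Rest : Type u := ((Set.range P.free)ᶜ : Set V)

/-- The independent sets of the graph induced on the vertices different from the chosen ones. -/
abbrev Indep : Type u :=
  {σ : Finset P.Rest // (G.induce (Set.range P.free)ᶜ).IsIndepSet (σ : Set P.Rest)}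

noncomputable instance [Finite V] : Fintype P.Rest := Fintype.ofFinite _

noncomputable instance [Finite V] : Fintype P.Indep := Fintype.ofFinite _

/-- The homomorphism from the polynomial ring in the cliques that sends each clique to the sum of its
variables. -/
noncomputable def theta [Fintype V] [DecidableEq ι] : MvPolynomial ι K →ₐ[K] EdgeRing K G :=
  MvPolynomial.aeval fun j => ∑ v with P.part v = j, edgeRingX K G v

/-- The squarefree monomial supported on an independent set. -/
noncomputable def mon (σ : P.Indep) : EdgeRing K G := ∏ w ∈ σ.1, edgeRingX K G w

theorem theta_X [Fintype V] [DecidableEq ι] (j : ι) : P.theta K (MvPolynomial.X j) =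
    ∑ v with P.part v = j, edgeRingX K G v := by simp [theta]

/-- In `S/I(G)` the square of a variable is its product with the sum over its clique, as the other
vertices of the clique are adjacent to it. -/
theorem theta_X_mul [Fintype V] [DecidableEq ι] (v : V) : P.theta K (MvPolynomial.X (P.part v)) * edgeRingX K G v =
    edgeRingX K G v * edgeRingX K G v := by
  rw [theta_X, Finset.sum_mul, Finset.sum_eq_single_of_mem v (by simp)]
  intro w hw hne
  exact edgeRingX_mul_edgeRingX (P.adj_of_part_eq hne (by simpa using hw))

theorem edgeRingX_free [Fintype V] [DecidableEq V] [DecidableEq ι] (j : ι) : edgeRingX K G (P.free j) = P.theta K (MvPolynomial.X j) -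
    ∑ w ∈ Finset.univ.filter fun w : P.Rest => P.part w = j, edgeRingX K G w := by
  rw [theta_X, eq_sub_iff_add_eq, ← Finset.add_sum_erase _ _ (a := P.free j) (by simp [P.part_free])]
  congr 1
  refine Finset.sum_bij (fun w _ => w.1) ?_ ?_ ?_ ?_
  · intro w hw
    have := w.2
    simp only [Set.mem_compl_iff, Set.mem_range, not_exists] at this
    simp only [Finset.mem_filter, Finset.mem_univ, true_and] at hw
    simp [hw, Ne.symm (this j)]
  · intro a _ b _ h
    exact Subtype.ext h
  · intro v hv
    simp only [Finset.mem_erase, Finset.mem_filter, Finset.mem_univ, true_and] at hv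
    refine ⟨⟨v, ?_⟩, by simpa using hv.2, rfl⟩
    rintro ⟨i, rfl⟩
    rw [P.part_free] at hv
    exact hv.1 (by rw [hv.2])
  · simp

theorem edgeRingX_mul_mon_of_mem [Fintype V] [DecidableEq V] [DecidableEq ι]
    {σ : P.Indep} {w : P.Rest} (h : w ∈ σ.1) :
    edgeRingX K G w * P.mon K σ = P.theta K (MvPolynomial.X (P.part w)) * P.mon K σ := by
  rw [mon, ← Finset.mul_prod_erase _ _ h, ← mul_assoc, ← mul_assoc, theta_X_mul]

theorem edgeRingX_mul_mon_of_isIndepSet [DecidableEq V] {σ : P.Indep} {w : P.Rest}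
    (h : w ∉ σ.1)
    (h' : (G.induce (Set.range P.free)ᶜ).IsIndepSet ((insert w σ.1 : Finset P.Rest) : Set P.Rest)) :
    edgeRingX K G w * P.mon K σ = P.mon K ⟨insert w σ.1, h'⟩ := by
  simp only [mon, Finset.prod_insert h]

theorem edgeRingX_mul_mon_of_not_isIndepSet [DecidableEq V] {σ : P.Indep} {w : P.Rest}
    (h' : ¬ (G.induce (Set.range P.free)ᶜ).IsIndepSet
      ((insert w σ.1 : Finset P.Rest) : Set P.Rest)) :
    edgeRingX K G w * P.mon K σ = 0 := by
  rw [Finset.coe_insert, IsIndepSet,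
    Set.pairwise_insert] at h'
  obtain ⟨b, hb, hadj⟩ : ∃ b ∈ σ.1, (G.induce (Set.range P.free)ᶜ).Adj w b := by
    by_contra! h0
    exact h' ⟨σ.2, fun b hb _ => ⟨h0 b hb, fun h => h0 b hb h.symm⟩⟩
  rw [mon, ← Finset.mul_prod_erase _ _ hb, ← mul_assoc,
    edgeRingX_mul_edgeRingX (induce_adj.1 hadj), zero_mul]

/-- The squarefree monomials supported on independent sets of the remaining graph span `S/I(G)` over
the polynomial ring in the clique sums. -/
theorem exists_eq_sum [Fintype V] [DecidableEq ι] (r : EdgeRing K G) :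
    ∃ a : P.Indep → MvPolynomial ι K, r = ∑ σ, P.theta K (a σ) * P.mon K σ := by
  classical
  let Q : EdgeRing K G → Prop := fun r => ∃ a : P.Indep → MvPolynomial ι K,
    r = ∑ σ, P.theta K (a σ) * P.mon K σ
  have hadd : ∀ r s, Q r → Q s → Q (r + s) := by
    rintro _ _ ⟨a, rfl⟩ ⟨b, rfl⟩
    exact ⟨a + b, by simp [add_mul, Finset.sum_add_distrib]⟩
  have hsmul : ∀ (t : MvPolynomial ι K) r, Q r → Q (P.theta K t * r) := by
    rintro t _ ⟨a, rfl⟩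
    exact ⟨fun σ => t * a σ, by simp [Finset.mul_sum, mul_assoc]⟩
  have hmon : ∀ σ, Q (P.mon K σ) := fun σ => ⟨Pi.single σ 1, by
    rw [Finset.sum_eq_single σ] <;> simp +contextual⟩
  have hzero : Q 0 := ⟨0, by simp⟩
  have hsum : ∀ {α : Type u} (s : Finset α) (g : α → EdgeRing K G), (∀ i, Q (g i)) →
      Q (∑ i ∈ s, g i) := fun s g hg => Finset.sum_induction _ Q hadd hzero fun i _ => hg i
  have hneg : ∀ r, Q r → Q (-r) := by
    rintro _ ⟨a, rfl⟩
    refine ⟨-a, ?_⟩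
    rw [← Finset.sum_neg_distrib]
    refine Finset.sum_congr rfl fun σ _ => ?_
    have h : P.theta K ((-a) σ) = -P.theta K (a σ) := map_neg _ _
    rw [h]
    ring
  have hXrest : ∀ (w : P.Rest) r, Q r → Q (r * edgeRingX K G w) := by
    rintro w _ ⟨a, rfl⟩
    rw [Finset.sum_mul]
    refine hsum _ _ fun σ => ?_
    rw [mul_assoc, mul_comm (P.mon K σ)]
    refine hsmul _ _ ?_
    by_cases h : w ∈ σ.1
    · rw [P.edgeRingX_mul_mon_of_mem K h]
      exact hsmul _ _ (hmon σ)
    · by_cases h' : (G.induce (Set.range P.free)ᶜ).IsIndepSet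
        ((insert w σ.1 : Finset P.Rest) : Set P.Rest)
      · rw [P.edgeRingX_mul_mon_of_isIndepSet K h h']
        exact hmon _
      · rw [P.edgeRingX_mul_mon_of_not_isIndepSet K h']
        exact hzero
  have hX : ∀ r v, Q r → Q (r * edgeRingX K G v) := by
    intro r v hr
    by_cases hv : v ∈ Set.range P.free
    · obtain ⟨j, rfl⟩ := hv
      rw [edgeRingX_free, mul_sub, sub_eq_add_neg, mul_comm]
      refine hadd _ _ (hsmul _ _ hr) (hneg _ ?_)
      rw [Finset.mul_sum]
      exact hsum _ _ fun w => hXrest w r hr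
    · exact hXrest ⟨v, hv⟩ r hr
  refine edgeRing_induction (P := Q) (fun a => ?_) hadd hX r
  have h1 : Q 1 := by simpa [mon] using hmon ⟨∅, by simp⟩
  simpa using hsmul (MvPolynomial.C a) 1 h1

/-- The squarefree monomials supported on independent sets of the remaining graph are linearly
independent over the polynomial ring in the clique sums: a relation is tested on the maximal
independent set of `G` that extends a minimal set `σ` with nonzero coefficient; there each variable
becomes the indeterminate of its clique and all monomials but that of `σ` vanish. -/
theorem eq_zero_of_sum_eq_zero [Fintype V] [DecidableEq ι]
    (a : P.Indep → MvPolynomial ι K)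
    (h : ∑ σ, P.theta K (a σ) * P.mon K σ = 0) : a = 0 := by
  classical
  by_contra hne
  obtain ⟨σ, hσ, hmin⟩ : ∃ σ : P.Indep, a σ ≠ 0 ∧ ∀ τ : P.Indep, a τ ≠ 0 → ¬ τ.1 ⊂ σ.1 := by
    have hs : {σ : P.Indep | a σ ≠ 0}.Nonempty := by
      by_contra h0
      refine hne (funext fun σ => ?_)
      by_contra h1
      exact h0 ⟨σ, h1⟩
    obtain ⟨σ, hσ⟩ := (Set.toFinite _).exists_minimal hs
    exact ⟨σ, hσ.prop, fun τ hτ hlt => hσ.not_lt hτ hlt⟩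
  -- the maximal independent set consisting of `σ` and the chosen vertices of the cliques that
  -- do not meet `σ`
  let y : V → MvPolynomial ι K := fun v =>
    if h : v ∈ Set.range P.free then
      if ∀ w ∈ σ.1, P.part w ≠ P.part v then MvPolynomial.X (P.part v) else 0
    else if (⟨v, h⟩ : P.Rest) ∈ σ.1 then MvPolynomial.X (P.part v) else 0
  have hyrest : ∀ w : P.Rest, y w = if w ∈ σ.1 then MvPolynomial.X (P.part w) else 0 :=
    fun w => dif_neg w.2
  have hyfree : ∀ j, y (P.free j) =
      if ∀ w ∈ σ.1, P.part w ≠ j then MvPolynomial.X j else 0 := by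
    intro j
    simp only [y]
    rw [dif_pos ⟨j, rfl⟩, P.part_free]
  have hadjfree : ∀ j w, G.Adj (P.free j) w → y (P.free j) * y w = 0 := by
    intro j w hadj
    have hp := P.part_eq_of_adj hadj
    by_cases hw : w ∈ Set.range P.free
    · obtain ⟨i, rfl⟩ := hw
      rw [P.part_free] at hp
      exact absurd (hp ▸ rfl) hadj.ne'
    · have := hyrest ⟨w, hw⟩
      simp only at this
      rw [hyfree, this]
      split_ifs with h1 h2 <;> simp
      exact h1 _ h2 hp
  have hy : ∀ v w, G.Adj v w → y v * y w = 0 := by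
    intro v w hadj
    by_cases hv : v ∈ Set.range P.free
    · obtain ⟨j, rfl⟩ := hv
      exact hadjfree j w hadj
    by_cases hw : w ∈ Set.range P.free
    · obtain ⟨j, rfl⟩ := hw
      rw [mul_comm]
      exact hadjfree j v hadj.symm
    have h1 := hyrest ⟨v, hv⟩
    have h2 := hyrest ⟨w, hw⟩
    simp only at h1 h2
    rw [h1, h2]
    split_ifs with h3 h4 <;> simp
    exact absurd hadj (σ.2 h3 h4 (by simpa using hadj.ne))
  let ψ := edgeRingLift K G y hy
  have hψθ : ∀ t, ψ (P.theta K t) = t := by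
    have : ψ.comp (P.theta K) = AlgHom.id K _ := by
      refine MvPolynomial.algHom_ext fun j => ?_
      rw [AlgHom.comp_apply, theta_X, map_sum, AlgHom.id_apply]
      simp only [ψ, edgeRingLift_edgeRingX]
      by_cases hj : ∀ w ∈ σ.1, P.part w ≠ j
      · rw [Finset.sum_eq_single_of_mem (P.free j) (by simp [P.part_free])]
        · rw [hyfree, if_pos hj]
        · intro v hv hvne
          simp only [Finset.mem_filter, Finset.mem_univ, true_and] at hv
          by_cases hvr : v ∈ Set.range P.free
          · obtain ⟨i, rfl⟩ := hvr
            rw [P.part_free] at hv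
            exact absurd (by rw [hv]) hvne
          · have := hyrest ⟨v, hvr⟩
            simp only at this
            rw [this, if_neg fun h => hj _ h hv]
      · push Not at hj
        obtain ⟨w, hw, hwj⟩ := hj
        rw [Finset.sum_eq_single_of_mem w.1 (by simp [hwj])]
        · rw [hyrest, if_pos hw, hwj]
        · intro v hv hvne
          simp only [Finset.mem_filter, Finset.mem_univ, true_and] at hv
          by_cases hvr : v ∈ Set.range P.free
          · obtain ⟨i, rfl⟩ := hvr
            rw [P.part_free] at hv
            rw [hyfree, if_neg]
            exact fun h => h w hw (hwj.trans hv.symm)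
          · have := hyrest ⟨v, hvr⟩
            simp only at this
            rw [this, if_neg]
            intro h
            exact σ.2 h hw (fun h => hvne (congrArg Subtype.val h))
              (P.adj_of_part_eq hvne (hv.trans hwj.symm))
    exact fun t => congr($this t)
  have hψmon : ∀ τ, ψ (P.mon K τ) =
      ∏ w ∈ τ.1, if w ∈ σ.1 then (MvPolynomial.X (P.part w) : MvPolynomial ι K) else 0 := by
    intro τ
    rw [mon, map_prod]
    simp only [ψ, edgeRingLift_edgeRingX, hyrest]
  have h0 := congrArg ψ h
  rw [map_sum, map_zero, Finset.sum_eq_single σ] at h0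
  · rw [map_mul, hψθ, hψmon, mul_eq_zero, or_iff_right hσ, Finset.prod_eq_zero_iff] at h0
    obtain ⟨w, hw, h0⟩ := h0
    rw [if_pos hw] at h0
    exact MvPolynomial.X_ne_zero _ h0
  · intro τ _ hτσ
    by_cases ha : a τ = 0
    · simp [ha]
    have : ¬ τ.1 ⊆ σ.1 := fun hle => hmin τ ha (hle.ssubset_of_ne fun h => hτσ (Subtype.ext h))
    obtain ⟨w, hw, hwσ⟩ := Finset.not_subset.1 this
    rw [map_mul, hψmon, Finset.prod_eq_zero hw (if_neg hwσ), mul_zero]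
  · simp

end FreeCliquePartition

end SimpleGraph

end

/-! ### The type of a graph with a free clique partition -/

section

open RingTheory.Sequence Module

section FreeExtension

variable {A : Type*} {R : Type u} [CommRing A] [CommRing R] {I : Type*} [Fintype I] (f : A →+* R)
  (b : I → R)

/-- A family in `R` through which every element of `R` can be written uniquely with coefficients
in `A` is a basis of `R` over `A`. -/
noncomputable def basisOfRingHom (hspan : ∀ r, ∃ a : I → A, r = ∑ i, f (a i) * b i)
    (hind : ∀ a : I → A, ∑ i, f (a i) * b i = 0 → a = 0) :
    letI := f.toAlgebra
    Basis I A R :=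
  letI := f.toAlgebra
  Basis.mk (v := b)
    (Fintype.linearIndependent_iff.2 fun a ha i => congrFun (hind a ha) i)
    (by
      intro r _
      obtain ⟨a, rfl⟩ := hspan r
      exact Submodule.sum_mem _ fun i _ =>
        Submodule.smul_mem _ (a i) (Submodule.subset_span ⟨i, rfl⟩))

/-- The coordinates with respect to `basisOfRingHom`, phrased without an `A`-module structure
on `R`. -/
theorem exists_coord (hspan : ∀ r, ∃ a : I → A, r = ∑ i, f (a i) * b i)
    (hind : ∀ a : I → A, ∑ i, f (a i) * b i = 0 → a = 0) :
    ∃ φ : R →+ (I → A), (∀ r, r = ∑ i, f (φ r i) * b i) ∧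
      (∀ a r i, φ (f a * r) i = a * φ r i) ∧ (∀ a, φ (∑ i, f (a i) * b i) = a) := by
  let := f.toAlgebra
  let B := basisOfRingHom f b hspan hind
  have hB : ∀ i, B i = b i := fun i => Basis.mk_apply _ _ _
  have hsum : ∀ r, r = ∑ i, f (B.equivFun r i) * b i := by
    intro r
    conv_lhs => rw [← B.sum_equivFun r]
    exact Finset.sum_congr rfl fun i _ => congrArg _ (hB i)
  refine ⟨B.equivFun.toLinearMap.toAddMonoidHom, hsum, ?_, ?_⟩
  · intro a r i
    exact congrFun (map_smul B.equivFun a r) i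
  · intro a
    rw [← sub_eq_zero]
    refine hind _ ?_
    simp only [Pi.sub_apply, map_sub, sub_mul, Finset.sum_sub_distrib, sub_eq_zero]
    exact (hsum _).symm

theorem isWeaklyRegular_map_of_basis (hspan : ∀ r, ∃ a : I → A, r = ∑ i, f (a i) * b i)
    (hind : ∀ a : I → A, ∑ i, f (a i) * b i = 0 → a = 0) {rs : List A}
    (h : IsWeaklyRegular A rs) : IsWeaklyRegular R (rs.map f) := by
  let := f.toAlgebra
  have := Module.Free.of_basis (basisOfRingHom f b hspan hind)
  exact h.of_flat (S := R)

theorem isCohenMacaulayRing_of_basis {K ι : Type*} [Field K] [Fintype ι]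
    (f : MvPolynomial ι K →+* R) (hspan : ∀ r, ∃ a : I → MvPolynomial ι K, r = ∑ i, f (a i) * b i)
    (hind : ∀ a : I → MvPolynomial ι K, ∑ i, f (a i) * b i = 0 → a = 0) :
    IsCohenMacaulayRing R := by
  let := f.toAlgebra
  have := Module.Finite.of_basis (basisOfRingHom f b hspan hind)
  have := Module.Free.of_basis (basisOfRingHom f b hspan hind)
  exact isCohenMacaulayRing_of_finite_flat (K := K) (ι := ι)

end FreeExtension

namespace SimpleGraph.FreeCliquePartition

variable {V : Type u} {G : SimpleGraph V} {ι : Type*} (P : G.FreeCliquePartition ι)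
  (K : Type w) [Field K] [Fintype V] [DecidableEq ι]

/-- The coordinates of an element of `S/I(G)` with respect to the monomials supported on
independent sets. -/
noncomputable def coord : EdgeRing K G →+ (P.Indep → MvPolynomial ι K) :=
  (exists_coord (P.theta K).toRingHom (P.mon K) (P.exists_eq_sum K)
    (P.eq_zero_of_sum_eq_zero K)).choose

theorem sum_coord (r : EdgeRing K G) : r = ∑ σ, P.theta K (P.coord K r σ) * P.mon K σ :=
  (exists_coord (P.theta K).toRingHom (P.mon K) (P.exists_eq_sum K)
    (P.eq_zero_of_sum_eq_zero K)).choose_spec.1 r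

theorem coord_theta_mul (t : MvPolynomial ι K) (r : EdgeRing K G) (σ : P.Indep) :
    P.coord K (P.theta K t * r) σ = t * P.coord K r σ :=
  (exists_coord (P.theta K).toRingHom (P.mon K) (P.exists_eq_sum K)
    (P.eq_zero_of_sum_eq_zero K)).choose_spec.2.1 t r σ

theorem coord_sum (a : P.Indep → MvPolynomial ι K) :
    P.coord K (∑ σ, P.theta K (a σ) * P.mon K σ) = a :=
  (exists_coord (P.theta K).toRingHom (P.mon K) (P.exists_eq_sum K)
    (P.eq_zero_of_sum_eq_zero K)).choose_spec.2.2 a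

/-- The constant terms of the coordinates of an element of `S/I(G)`. -/
noncomputable def constCoeff (σ : P.Indep) : EdgeRing K G →+ K :=
  (MvPolynomial.constantCoeff (R := K) (σ := ι)).toAddMonoidHom.comp
    ((Pi.evalAddMonoidHom _ σ).comp (P.coord K))

theorem constCoeff_apply (σ : P.Indep) (r : EdgeRing K G) :
    P.constCoeff K σ r = MvPolynomial.constantCoeff (P.coord K r σ) := rfl

theorem constCoeff_theta_mul (σ : P.Indep) (t : MvPolynomial ι K) (r : EdgeRing K G) :
    P.constCoeff K σ (P.theta K t * r) = MvPolynomial.constantCoeff t * P.constCoeff K σ r := by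
  rw [constCoeff_apply, coord_theta_mul, map_mul, constCoeff_apply]

open scoped Classical in
theorem constCoeff_mon (σ τ : P.Indep) :
    P.constCoeff K σ (P.mon K τ) = if τ = σ then 1 else 0 := by
  have h : P.mon K τ = ∑ ρ, P.theta K ((Pi.single τ 1 : P.Indep → MvPolynomial ι K) ρ) * P.mon K ρ := by
    rw [Finset.sum_eq_single τ] <;> simp +contextual
  rw [constCoeff_apply, h, coord_sum, Pi.single_apply]
  split_ifs with h1 h2 h2
  · simp
  · exact absurd h1.symm h2
  · exact absurd h2.symm h1
  · simp

theorem exists_eq_sum_constCoeff (r : EdgeRing K G) :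
    ∃ a : P.Indep → MvPolynomial ι K, r = ∑ σ, P.theta K (a σ) * P.mon K σ ∧
      ∀ σ, MvPolynomial.constantCoeff (a σ) = P.constCoeff K σ r :=
  ⟨P.coord K r, P.sum_coord K r, fun _ => rfl⟩

theorem theta_mem_of_constantCoeff_eq_zero {J : Ideal (EdgeRing K G)}
    (hJ : ∀ j, P.theta K (MvPolynomial.X j) ∈ J) (t : MvPolynomial ι K)
    (ht : MvPolynomial.constantCoeff t = 0) : P.theta K t ∈ J := by
  have h : t - MvPolynomial.C (MvPolynomial.constantCoeff t) ∈ J.comap (P.theta K) := by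
    clear ht
    induction t using MvPolynomial.induction_on with
    | C a => simp
    | add p q hp hq =>
      convert add_mem hp hq using 1
      simp only [map_add]
      ring
    | mul_X p j _ =>
      simp only [map_mul, MvPolynomial.constantCoeff_X, mul_zero, map_zero, sub_zero]
      exact Ideal.mul_mem_left _ _ (hJ j)
  simpa [ht] using h

/-- The ideal generated by the clique sums consists of the elements all of whose coordinates have
vanishing constant term. -/
theorem mem_span_iff (r : EdgeRing K G) :
    r ∈ Ideal.span (Set.range fun j => P.theta K (MvPolynomial.X j)) ↔
      ∀ σ, P.constCoeff K σ r = 0 := by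
  constructor
  · intro hr σ
    suffices h : ∀ s, P.constCoeff K σ (s * r) = 0 by simpa using h 1
    refine Submodule.span_induction (p := fun r _ => ∀ s, P.constCoeff K σ (s * r) = 0)
      ?_ ?_ ?_ ?_ hr
    · rintro _ ⟨j, rfl⟩ s
      rw [mul_comm, constCoeff_theta_mul, MvPolynomial.constantCoeff_X, zero_mul]
    · simp
    · intro x y _ _ hx hy s
      rw [mul_add, map_add, hx, hy, add_zero]
    · intro a x _ hx s
      rw [smul_eq_mul, ← mul_assoc]
      exact hx _
  · intro h
    obtain ⟨a, ha, hc⟩ := P.exists_eq_sum_constCoeff K r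
    rw [ha]
    refine Ideal.sum_mem _ fun σ _ => Ideal.mul_mem_right _ _ ?_
    exact P.theta_mem_of_constantCoeff_eq_zero K (fun j => Ideal.subset_span (Set.mem_range_self j)) _
      ((hc σ).trans (h σ))

include P in
theorem isCohenMacaulayOver [Fintype ι] : IsCohenMacaulayOver K G :=
  isCohenMacaulayRing_of_basis (P.mon K) (P.theta K).toRingHom (P.exists_eq_sum K)
    (P.eq_zero_of_sum_eq_zero K)

theorem exists_isRegular [Fintype ι] : ∃ rs : List (EdgeRing K G),
    Ideal.ofList rs = Ideal.span (Set.range fun j => P.theta K (MvPolynomial.X j)) ∧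
    (∀ r ∈ rs, r ∈ edgeRingIrrelevant K G) ∧ IsRegular (EdgeRing K G) rs := by
  obtain ⟨rs, -, hmem, hrs⟩ := MvPolynomial.exists_isWeaklyRegular_of_monic (k := K) (ι := ι)
    (fun _ => Polynomial.X) fun _ => Polynomial.monic_X
  simp only [Polynomial.aeval_X] at hmem
  have hθ : ∀ j, P.theta K (MvPolynomial.X j) ∈ edgeRingIrrelevant K G := by
    intro j
    rw [theta_X]
    exact Ideal.sum_mem _ fun v _ => edgeRingX_mem_irrelevant v
  have hm : ∀ r ∈ rs.map (P.theta K), r ∈ edgeRingIrrelevant K G := by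
    intro r hr
    obtain ⟨a, ha, rfl⟩ := List.mem_map.1 hr
    obtain ⟨j, rfl⟩ := (hmem a).1 ha
    exact hθ j
  refine ⟨rs.map (P.theta K), ?_, hm, 
    isWeaklyRegular_map_of_basis (P.theta K).toRingHom (P.mon K) (P.exists_eq_sum K)
      (P.eq_zero_of_sum_eq_zero K) hrs, ?_⟩
  · rw [Ideal.ofList]
    congr 1
    ext r
    simp only [Set.mem_ofPred_eq, List.mem_map, Set.mem_range, hmem]
    constructor
    · rintro ⟨_, ⟨j, rfl⟩, rfl⟩
      exact ⟨j, rfl⟩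
    · rintro ⟨j, rfl⟩
      exact ⟨_, ⟨j, rfl⟩, rfl⟩
  · intro h
    have hle : Ideal.ofList (rs.map (P.theta K)) ≤ edgeRingIrrelevant K G := Ideal.span_le.2 hm
    have : (⊤ : Ideal (EdgeRing K G)) ≤ edgeRingIrrelevant K G := by
      rw [h, smul_eq_mul, Ideal.mul_top]
      exact hle
    exact isMaximal_edgeRingIrrelevant.ne_top (top_le_iff.1 this)

/-- The maximal independent sets of the graph induced on the vertices different from the chosen
ones. -/
abbrev MaxIndep : Type u :=
  {σ : P.Indep // Maximal (G.induce (Set.range P.free)ᶜ).IsIndepSet (σ.1 : Set P.Rest)}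

omit [DecidableEq ι] in
theorem natCard_maxIndep : Nat.card P.MaxIndep =
    (G.induce (Set.range P.free)ᶜ).numMaximalIndepSets := by
  classical
  rw [numMaximalIndepSets, ← Nat.card_coe_set_eq]
  refine Nat.card_congr (Equiv.ofBijective (fun σ => ⟨_, σ.2⟩) ⟨?_, ?_⟩)
  · intro σ τ h
    exact Subtype.ext (Subtype.ext (Finset.coe_injective (congrArg Subtype.val h)))
  · rintro ⟨s, hs⟩
    exact ⟨⟨⟨(Set.toFinite s).toFinset, by simpa using hs.prop⟩, by simpa using hs⟩, by simp⟩

omit [Fintype V] [DecidableEq ι] in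
theorem exists_insert_of_not_maximal [DecidableEq V] {σ : P.Indep}
    (h : ¬ Maximal (G.induce (Set.range P.free)ᶜ).IsIndepSet (σ.1 : Set P.Rest)) :
    ∃ w ∉ σ.1, (G.induce (Set.range P.free)ᶜ).IsIndepSet
      ((insert w σ.1 : Finset P.Rest) : Set P.Rest) := by
  obtain ⟨t, hlt, ht⟩ := exists_gt_of_not_maximal σ.2 h
  obtain ⟨w, hw, hwσ⟩ := Set.exists_of_ssubset hlt
  refine ⟨w, hwσ, Set.Pairwise.mono ?_ ht⟩
  rw [Finset.coe_insert]
  exact Set.insert_subset hw hlt.le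

omit [Fintype V] [DecidableEq ι] in
theorem not_isIndepSet_insert_of_maximal [DecidableEq V] {σ : P.Indep}
    (h : Maximal (G.induce (Set.range P.free)ᶜ).IsIndepSet (σ.1 : Set P.Rest)) {w : P.Rest}
    (hw : w ∉ σ.1) : ¬ (G.induce (Set.range P.free)ᶜ).IsIndepSet
      ((insert w σ.1 : Finset P.Rest) : Set P.Rest) :=
  fun hi => hw (h.le_of_ge hi (by simp) (by simp))

theorem edgeRingX_mul_mem_span {r : EdgeRing K G}
    (h : ∀ w : P.Rest, edgeRingX K G w * r ∈
      Ideal.span (Set.range fun j => P.theta K (MvPolynomial.X j)))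
    {a : EdgeRing K G} (ha : a ∈ edgeRingIrrelevant K G) :
    a * r ∈ Ideal.span (Set.range fun j => P.theta K (MvPolynomial.X j)) := by
  classical
  set J := Ideal.span (Set.range fun j => P.theta K (MvPolynomial.X j))
  have hle : edgeRingIrrelevant K G ≤ Submodule.colon J {r} := by
    rw [edgeRingIrrelevant, Ideal.span_le]
    rintro _ ⟨v, rfl⟩
    change edgeRingX K G v ∈ _
    rw [SetLike.mem_coe, Submodule.mem_colon_singleton, smul_eq_mul]
    by_cases hv : v ∈ Set.range P.free
    · obtain ⟨j, rfl⟩ := hv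
      rw [edgeRingX_free, sub_mul, Finset.sum_mul]
      exact sub_mem (Ideal.mul_mem_right _ _ (Ideal.subset_span ⟨j, rfl⟩))
        (Ideal.sum_mem _ fun w _ => h w)
    · exact h ⟨v, hv⟩
  simpa [Submodule.mem_colon_singleton] using hle ha

theorem mul_mon_mem_span (σ : P.MaxIndep) {a : EdgeRing K G} (ha : a ∈ edgeRingIrrelevant K G) :
    a * P.mon K σ.1 ∈ Ideal.span (Set.range fun j => P.theta K (MvPolynomial.X j)) := by
  classical
  refine P.edgeRingX_mul_mem_span K (fun w => ?_) ha
  by_cases hw : w ∈ σ.1.1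
  · rw [P.edgeRingX_mul_mon_of_mem K hw]
    exact Ideal.mul_mem_right _ _ (Ideal.subset_span ⟨_, rfl⟩)
  · rw [P.edgeRingX_mul_mon_of_not_isIndepSet K (P.not_isIndepSet_insert_of_maximal σ.2 hw)]
    exact zero_mem _

theorem constCoeff_edgeRingX_mul [DecidableEq V] {σ : P.Indep} {w : P.Rest} (hw : w ∉ σ.1)
    (h : (G.induce (Set.range P.free)ᶜ).IsIndepSet ((insert w σ.1 : Finset P.Rest) : Set P.Rest))
    (r : EdgeRing K G) :
    P.constCoeff K ⟨insert w σ.1, h⟩ (edgeRingX K G w * r) = P.constCoeff K σ r := by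
  obtain ⟨a, ha, hc⟩ := P.exists_eq_sum_constCoeff K r
  rw [← hc]
  nth_rw 1 [ha]
  rw [Finset.mul_sum, map_sum, Finset.sum_eq_single σ]
  · rw [mul_left_comm, constCoeff_theta_mul, P.edgeRingX_mul_mon_of_isIndepSet K hw h,
      constCoeff_mon, if_pos rfl, mul_one]
  · intro τ _ hτ
    rw [mul_left_comm, constCoeff_theta_mul]
    by_cases hwτ : w ∈ τ.1
    · rw [P.edgeRingX_mul_mon_of_mem K hwτ, constCoeff_theta_mul, MvPolynomial.constantCoeff_X,
        zero_mul, mul_zero]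
    by_cases h' : (G.induce (Set.range P.free)ᶜ).IsIndepSet
        ((insert w τ.1 : Finset P.Rest) : Set P.Rest)
    · rw [P.edgeRingX_mul_mon_of_isIndepSet K hwτ h', constCoeff_mon, if_neg, mul_zero]
      intro heq
      refine hτ (Subtype.ext ?_)
      have := congrArg Subtype.val heq
      rw [← Finset.erase_insert hwτ, ← Finset.erase_insert hw]
      exact congrArg (Finset.erase · w) this
    · rw [P.edgeRingX_mul_mon_of_not_isIndepSet K h', map_zero, mul_zero]
  · simp

theorem cohenMacaulayType_eq [Fintype ι] : cohenMacaulayType (edgeRingIrrelevant K G) =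
    ((G.induce (Set.range P.free)ᶜ).numMaximalIndepSets : ℕ) := by
  classical
  obtain ⟨rs, hspan, hmem, hreg⟩ := P.exists_isRegular K
  have : Fintype P.MaxIndep := Fintype.ofFinite _
  have : Nonempty P.MaxIndep := by
    obtain ⟨s, -, hs⟩ := (Set.toFinite {s : Set P.Rest |
      (G.induce (Set.range P.free)ᶜ).IsIndepSet s}).exists_le_maximal (a := ∅) (by simp)
    exact ⟨⟨⟨(Set.toFinite s).toFinset, by simpa using hs.prop⟩, by simpa using hs⟩⟩
  rw [← P.natCard_maxIndep, Nat.card_eq_fintype_card]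
  set J := Ideal.span (Set.range fun j => P.theta K (MvPolynomial.X j)) with hJ
  have hcoeff : ∀ (r : P.MaxIndep → K) (σ : P.Indep),
      P.constCoeff K σ (∑ τ, P.theta K (MvPolynomial.C (r τ)) * P.mon K τ.1) =
        if h : Maximal (G.induce (Set.range P.free)ᶜ).IsIndepSet (σ.1 : Set P.Rest)
        then r ⟨σ, h⟩ else 0 := by
    intro r σ
    rw [map_sum]
    simp only [constCoeff_theta_mul, constCoeff_mon, MvPolynomial.constantCoeff_C]
    split_ifs with h
    · rw [Finset.sum_eq_single ⟨σ, h⟩]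
      · simp
      · intro τ _ hτ
        rw [if_neg fun h => hτ (Subtype.ext h), mul_zero]
      · simp
    · refine Finset.sum_eq_zero fun τ _ => ?_
      rw [if_neg, mul_zero]
      rintro rfl
      exact h τ.2
  refine cohenMacaulayType_eq_card _ rs hmem hreg (fun σ : P.MaxIndep => P.mon K σ.1) ?_ ?_ ?_
  · intro σ a ha
    rw [hspan]
    exact P.mul_mon_mem_span K σ ha
  · intro r hr
    rw [hspan] at hr
    choose c hc using fun σ => exists_sub_algebraMap_mem_irrelevant (r σ)
    have h1 : ∑ σ, (r σ - algebraMap K _ (c σ)) * P.mon K σ.1 ∈ J :=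
      Ideal.sum_mem _ fun σ _ => P.mul_mon_mem_span K σ (hc σ)
    have h2 : ∑ τ, P.theta K (MvPolynomial.C (c τ)) * P.mon K τ.1 ∈ J := by
      convert sub_mem hr h1 using 1
      rw [← Finset.sum_sub_distrib]
      refine Finset.sum_congr rfl fun σ _ => ?_
      have : P.theta K (MvPolynomial.C (c σ)) = algebraMap K _ (c σ) :=
        (P.theta K).commutes (c σ)
      rw [this]
      ring
    intro σ
    have h3 := (P.mem_span_iff K _).1 h2 σ.1
    rw [hcoeff, dif_pos σ.2] at h3
    have h3 : c σ = 0 := h3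
    simpa [h3] using hc σ
  · intro x hx
    rw [hspan] at hx
    refine ⟨fun σ => P.theta K (MvPolynomial.C (P.constCoeff K σ.1 x)), ?_⟩
    rw [hspan, P.mem_span_iff]
    intro σ
    rw [map_sub, hcoeff]
    split_ifs with h
    · rw [sub_self]
    · obtain ⟨w, hw, hi⟩ := P.exists_insert_of_not_maximal h
      rw [← P.constCoeff_edgeRingX_mul K hw hi, sub_zero]
      exact (P.mem_span_iff K _).1 (hx _ (edgeRingX_mem_irrelevant _)) _

end SimpleGraph.FreeCliquePartition

end

/-! ### Cohen-Macaulay graphs are well-covered -/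

section

open RingTheory.Sequence Module

namespace SimpleGraph

variable {V : Type u} (K : Type w) [Field K] (G : SimpleGraph V)

open scoped Classical in
/-- The restriction of `S/I(G)` to the variables in an independent set. -/
noncomputable def edgeRingRestrict (s : Finset V) (hs : G.IsIndepSet (s : Set V)) :
    EdgeRing K G →ₐ[K] MvPolynomial V K :=
  edgeRingLift K G (fun v => if v ∈ s then MvPolynomial.X v else 0) (by
    intro v w h
    split_ifs with hv hw <;> simp
    exact hs hv hw h.ne h)

variable {G}

open scoped Classical in
theorem edgeRingRestrict_edgeRingX {s : Finset V} (hs : G.IsIndepSet (s : Set V)) (v : V) :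
    edgeRingRestrict K G s hs (edgeRingX K G v) = if v ∈ s then MvPolynomial.X v else 0 :=
  edgeRingLift_edgeRingX _ _ v

theorem ker_edgeRingRestrict_lt [DecidableEq V] {s : Finset V} {v : V} (hv : v ∉ s)
    (hs : G.IsIndepSet (s : Set V)) (hs' : G.IsIndepSet ((insert v s : Finset V) : Set V)) :
    RingHom.ker (edgeRingRestrict K G _ hs') < RingHom.ker (edgeRingRestrict K G s hs) := by
  let g : MvPolynomial V K →ₐ[K] MvPolynomial V K :=
    MvPolynomial.aeval fun w => if w ∈ s then MvPolynomial.X w else 0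
  have hg : ∀ r, g (edgeRingRestrict K G _ hs' r) = edgeRingRestrict K G s hs r := by
    intro r
    induction r using edgeRing_induction with
    | hC a => simp only [AlgHom.commutes]
    | hadd r t hr ht => simp only [map_add, hr, ht]
    | hX r w hr =>
      rw [map_mul, map_mul, map_mul, hr, edgeRingRestrict_edgeRingX, edgeRingRestrict_edgeRingX]
      congr 1
      by_cases hw : w ∈ s
      · simp [hw, g]
      · by_cases hwv : w = v
        · simp [hwv, g, hv]
        · simp [hw, hwv, g]
  refine lt_of_le_of_ne (fun r hr => ?_) fun h => ?_
  · rw [RingHom.mem_ker] at hr ⊢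
    rw [← hg, hr, map_zero]
  · have h1 : edgeRingX K G v ∈ RingHom.ker (edgeRingRestrict K G s hs) := by
      rw [RingHom.mem_ker, edgeRingRestrict_edgeRingX, if_neg hv]
    rw [← h, RingHom.mem_ker, edgeRingRestrict_edgeRingX, if_pos (by simp)] at h1
    exact MvPolynomial.X_ne_zero v h1

instance {s : Finset V} (hs : G.IsIndepSet (s : Set V)) :
    (RingHom.ker (edgeRingRestrict K G s hs)).IsPrime :=
  RingHom.ker_isPrime _

/-- Adding the vertices of `t` to `s` one by one gives a chain of primes below the ideal of `s`. -/
theorem card_le_height_ker_edgeRingRestrict [Finite V] [DecidableEq V] (t : Finset V) :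
    ∀ (s : Finset V), Disjoint s t → G.IsIndepSet ((s ∪ t : Finset V) : Set V) →
      ∀ hs : G.IsIndepSet (s : Set V),
      (t.card : ℕ∞) ≤ (RingHom.ker (edgeRingRestrict K G s hs)).height := by
  induction t using Finset.induction_on with
  | empty => simp
  | insert v t hv ih =>
    intro s hdisj hi hs
    rw [Finset.disjoint_insert_right] at hdisj
    have hs' : G.IsIndepSet ((insert v s : Finset V) : Set V) := by
      refine Set.Pairwise.mono ?_ hi
      intro x
      simp only [Finset.coe_insert, Finset.coe_union, Set.mem_insert_iff, Set.mem_union,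
        Finset.mem_coe]
      tauto
    have h1 := ih (insert v s) (Finset.disjoint_insert_left.2 ⟨hv, hdisj.2⟩)
      (by rwa [Finset.insert_union, ← Finset.union_insert]) hs'
    have h2 := Ideal.height_add_one_le_of_lt_of_isPrime
      (ker_edgeRingRestrict_lt K hdisj.1 hs hs')
    rw [Finset.card_insert_of_notMem hv]
    push_cast
    exact (add_le_add_left h1 1).trans h2

theorem card_le_height_edgeRingIrrelevant [Finite V] {t : Finset V}
    (ht : G.IsIndepSet (t : Set V)) : (t.card : ℕ∞) ≤ (edgeRingIrrelevant K G).height := by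
  classical
  have h := card_le_height_ker_edgeRingRestrict K (G := G) t ∅ (by simp) (by simpa using ht)
    (by simp)
  have heq : edgeRingIrrelevant K G = RingHom.ker (edgeRingRestrict K G ∅ (by simp)) := by
    refine isMaximal_edgeRingIrrelevant.eq_of_le Ideal.IsPrime.ne_top' ?_
    rw [edgeRingIrrelevant, Ideal.span_le]
    rintro _ ⟨v, rfl⟩
    exact (edgeRingRestrict_edgeRingX K _ v).trans (by simp)
  rwa [heq]

/-- For a maximal independent set, the ideal generated by the other variables is the annihilator
of the squarefree monomial supported on the set. -/
theorem ker_edgeRingRestrict_mem_associatedPrimes [Finite V] {s : Finset V}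
    (hs : Maximal G.IsIndepSet (s : Set V)) :
    RingHom.ker (edgeRingRestrict K G s hs.prop) ∈ associatedPrimes (EdgeRing K G)
      (EdgeRing K G) := by
  classical
  rw [AssociatedPrimes.mem_iff, isAssociatedPrime_iff]
  refine ⟨inferInstance, ∏ v ∈ s, edgeRingX K G v, ?_⟩
  set z := ∏ v ∈ s, edgeRingX K G v with hz
  have hzero : ∀ v ∉ s, edgeRingX K G v * z = 0 := by
    intro v hv
    have h : ¬ G.IsIndepSet (insert v (s : Set V)) := fun hi =>
      hv (hs.le_of_ge hi (Set.subset_insert _ _) (Set.mem_insert _ _))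
    obtain ⟨b, hb, hadj⟩ : ∃ b ∈ s, G.Adj v b := by
      by_contra! h0
      refine h ?_
      rw [IsIndepSet, Set.pairwise_insert]
      exact ⟨hs.prop, fun b hb _ => ⟨h0 b hb, fun h => h0 b hb h.symm⟩⟩
    rw [hz, ← Finset.mul_prod_erase _ _ hb, ← mul_assoc, edgeRingX_mul_edgeRingX hadj, zero_mul]
  have hmul : ∀ r, r * z =
      Ideal.Quotient.mk (edgeIdeal K G) (edgeRingRestrict K G s hs.prop r) * z := by
    intro r
    induction r using edgeRing_induction with
    | hC a => rw [AlgHom.commutes]; rfl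
    | hadd r t hr ht => simp only [map_add, add_mul, hr, ht]
    | hX r v hr =>
      rw [map_mul, map_mul, edgeRingRestrict_edgeRingX]
      split_ifs with hv
      · rw [mul_right_comm, hr, mul_right_comm]
        rfl
      · rw [mul_assoc, hzero v hv, map_zero, mul_zero, mul_zero, zero_mul]
  ext r
  rw [Submodule.mem_colon_singleton, Submodule.mem_bot, smul_eq_mul, RingHom.mem_ker]
  constructor
  · intro hr
    rw [hmul, hr, map_zero, zero_mul]
  · intro hr
    have h := congrArg (edgeRingRestrict K G s hs.prop) hr
    rw [map_mul, map_zero, mul_eq_zero] at h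
    refine h.resolve_right ?_
    rw [hz, map_prod, ← Ne, Finset.prod_ne_zero_iff]
    intro v hv
    rw [edgeRingRestrict_edgeRingX, if_pos hv]
    exact MvPolynomial.X_ne_zero v

/-- For a maximal independent set `s`, the localization of `S/I(G)` at the irrelevant ideal has an
associated prime with residue ring of dimension at most `|s|`. -/
theorem length_le_card_of_isRegular_localization [Finite V] {s : Finset V}
    (hs : Maximal G.IsIndepSet (s : Set V)) {A : Type*} [CommRing A] [IsLocalRing A]
    [IsNoetherianRing A] [Algebra (EdgeRing K G) A]
    [IsLocalization.AtPrime A (edgeRingIrrelevant K G)] (rs : List A) (hrs : IsRegular A rs) :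
    rs.length ≤ s.card := by
  classical
  set m := edgeRingIrrelevant K G
  let P := RingHom.ker (edgeRingRestrict K G s hs.prop)
  have hPX : ∀ v ∉ s, edgeRingX K G v ∈ P := by
    intro v hv
    exact (edgeRingRestrict_edgeRingX K _ v).trans (if_neg hv)
  have hPm : P ≤ m := by
    intro r hr
    obtain ⟨a, ha⟩ := exists_sub_algebraMap_mem_irrelevant r
    have hle : m ≤ RingHom.ker ((MvPolynomial.constantCoeff (σ := V)).comp
        (edgeRingRestrict K G s hs.prop).toRingHom) := by
      refine Ideal.span_le.2 ?_
      rintro _ ⟨v, rfl⟩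
      change MvPolynomial.constantCoeff (edgeRingRestrict K G s hs.prop (edgeRingX K G v)) = 0
      rw [edgeRingRestrict_edgeRingX]
      split_ifs <;> simp
    have h : MvPolynomial.constantCoeff
        (edgeRingRestrict K G s hs.prop (r - algebraMap K _ a)) = 0 := hle ha
    have hr' : edgeRingRestrict K G s hs.prop r = 0 := hr
    rw [map_sub, hr', AlgHom.commutes, zero_sub, map_neg, neg_eq_zero,
      MvPolynomial.algebraMap_eq, MvPolynomial.constantCoeff_C] at h
    simpa [h] using ha
  let p : Ideal A := P.map (algebraMap _ A)
  have hdisj : Disjoint (m.primeCompl : Set (EdgeRing K G)) P :=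
    Set.disjoint_left.2 fun r hr hrP => hr (hPm hrP)
  have hp : p ∈ associatedPrimes A A := by
    refine Module.associatedPrimes.mem_associatedPrimes_of_comap_mem_associatedPrimes_of_isLocalizedModule
      m.primeCompl (Algebra.linearMap (EdgeRing K G) A) p ?_
    have hcomap : p.comap (algebraMap _ A) = P :=
      IsLocalization.under_map_of_isPrime_disjoint m.primeCompl A inferInstance hdisj
    rw [hcomap]
    exact ker_edgeRingRestrict_mem_associatedPrimes K hs
  have hpprime : p.IsPrime := hp.isPrime
  have hdim : ringKrullDim (A ⧸ p) ≤ s.card := by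
    have := IsLocalRing.of_surjective' (Ideal.Quotient.mk p) Ideal.Quotient.mk_surjective
    let y : V → A ⧸ p := fun v => Ideal.Quotient.mk p (algebraMap _ A (edgeRingX K G v))
    have hspan : IsLocalRing.maximalIdeal (A ⧸ p) = Ideal.span (y '' s) := by
      have h1 : (IsLocalRing.maximalIdeal A).map (Ideal.Quotient.mk p) =
          IsLocalRing.maximalIdeal (A ⧸ p) := by
        exact IsLocalRing.map_maximalIdeal_of_surjective _ Ideal.Quotient.mk_surjective
      rw [← h1, ← IsLocalization.AtPrime.map_eq_maximalIdeal m A, Ideal.map_map]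
      change Ideal.map _ (Ideal.span _) = _
      rw [Ideal.map_span, ← Set.range_comp]
      refine le_antisymm (Ideal.span_le.2 ?_) (Ideal.span_mono ?_)
      · rintro _ ⟨v, rfl⟩
        by_cases hv : v ∈ s
        · exact Ideal.subset_span ⟨v, hv, rfl⟩
        · have : y v = 0 := Ideal.Quotient.eq_zero_iff_mem.2
            (Ideal.mem_map_of_mem _ (hPX v hv))
          change y v ∈ _
          rw [this]
          exact zero_mem _
      · rintro _ ⟨v, -, rfl⟩
        exact ⟨v, rfl⟩
    refine (ringKrullDim_le_spanFinrank_maximalIdeal _).trans ?_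
    rw [hspan]
    have h2 := Submodule.spanFinrank_span_le_ncard_of_finite (R := A ⧸ p)
      (s.finite_toSet.image y)
    have h3 := Set.ncard_image_le (f := y) s.finite_toSet
    rw [Set.ncard_coe_finset] at h3
    exact_mod_cast h2.trans h3
  exact_mod_cast (hrs.length_le_ringKrullDim_quotient rs p hp).trans hdim

/-- Cohen-Macaulay graphs are well-covered: all maximal independent sets have the same size. -/
theorem IsCohenMacaulayOver.card_le_card [Finite V] (hG : IsCohenMacaulayOver K G) {s t : Finset V}
    (hs : Maximal G.IsIndepSet (s : Set V)) (ht : G.IsIndepSet (t : Set V)) :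
    t.card ≤ s.card := by
  have hCM := (hG.2 (edgeRingIrrelevant K G)).2
  have hdepth : idealDepth (R := Localization.AtPrime (edgeRingIrrelevant K G))
      (IsLocalRing.maximalIdeal _) ≤ s.card := by
    refine idealDepth_le fun rs _ hrs => ?_
    exact_mod_cast length_le_card_of_isRegular_localization K hs rs hrs
  have h := card_le_height_edgeRingIrrelevant K ht
  have h2 : ((edgeRingIrrelevant K G).height : WithBot ℕ∞) ≤ ((s.card : ℕ∞) : WithBot ℕ∞) := by
    rw [← IsLocalization.AtPrime.ringKrullDim_eq_height (edgeRingIrrelevant K G)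
      (Localization.AtPrime (edgeRingIrrelevant K G)), ← hCM]
    exact WithBot.coe_le_coe.2 hdepth
  have h3 := h.trans (WithBot.coe_le_coe.1 h2)
  exact_mod_cast h3

end SimpleGraph

end

/-! ### Well-covered chordal graphs -/

section

namespace SimpleGraph

variable {V : Type u} {G : SimpleGraph V}

/-- `C` induces a preconnected subgraph: any two of its vertices are joined by a walk within `C`. -/
def IsPreconnectedSet (G : SimpleGraph V) (C : Set V) : Prop :=
  ∀ a ∈ C, ∀ b ∈ C, ∃ p : G.Walk a b, ∀ x ∈ p.support, x ∈ C

theorem exists_shorter_walk_of_adj {a b x y : V} (A : G.Walk a x) (B : G.Walk x y) (D : G.Walk y b)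
    (hxy : G.Adj x y) (hB : s(x, y) ∉ B.edges) :
    (A.append (Walk.cons hxy D)).length < (A.append (B.append D)).length := by
  cases B with
  | nil => exact absurd hxy (G.loopless.irrefl _)
  | cons h B =>
    cases B with
    | nil => simp at hB
    | cons h' B =>
      simp only [Walk.length_append, Walk.length_cons]
      omega

/-- In a chordal graph, two adjacent vertices `r`, `q` that both have neighbours in a preconnected
set have a common neighbour there: a shortest walk in the set from a neighbour of `r` to a neighbour
of `q`, closed up by `r` and `q`, is a cycle without chords. -/
theorem IsChordal.exists_common_neighbor (hG : G.IsChordal) {r q : V} (hrq : G.Adj r q) {C : Set V}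
    (hr : r ∉ C) (hq : q ∉ C) (hC : G.IsPreconnectedSet C) {a b : V} (ha : a ∈ C)
    (hra : G.Adj r a) (hb : b ∈ C) (hqb : G.Adj q b) : ∃ c ∈ C, G.Adj r c ∧ G.Adj q c := by
  classical
  let S : Set ℕ := {n | ∃ (a b : V) (p : G.Walk a b), G.Adj r a ∧ G.Adj q b ∧
    (∀ x ∈ p.support, x ∈ C) ∧ p.length = n}
  have hS : S.Nonempty := by
    obtain ⟨p, hp⟩ := hC a ha b hb
    exact ⟨_, a, b, p, hra, hqb, hp, rfl⟩
  obtain ⟨a, b, p₀, hra, hqb, hp₀, hlen⟩ := Nat.sInf_mem hS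
  have hmin₀ : ∀ (a' b' : V) (p' : G.Walk a' b'), G.Adj r a' → G.Adj q b' →
      (∀ x ∈ p'.support, x ∈ C) → p₀.length ≤ p'.length :=
    fun a' b' p' h1 h2 h3 => hlen ▸ Nat.sInf_le ⟨a', b', p', h1, h2, h3, rfl⟩
  obtain ⟨p, hpath, hp, hmin⟩ : ∃ p : G.Walk a b, p.IsPath ∧ (∀ x ∈ p.support, x ∈ C) ∧
      ∀ (a' b' : V) (p' : G.Walk a' b'), G.Adj r a' → G.Adj q b' →
        (∀ x ∈ p'.support, x ∈ C) → p.length ≤ p'.length :=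
    ⟨p₀.bypass, p₀.bypass_isPath, fun x hx => hp₀ x (p₀.support_bypass_subset_support hx),
      fun a' b' p' h1 h2 h3 => p₀.length_bypass_le_length.trans (hmin₀ a' b' p' h1 h2 h3)⟩
  by_cases hp0 : p.length = 0
  · have := Walk.eq_of_length_eq_zero hp0
    subst this
    exact ⟨a, hp a (by simp), hra, hqb⟩
  exfalso
  have hrp : r ∉ p.support := fun h => hr (hp r h)
  have hqp : q ∉ p.support := fun h => hq (hp q h)
  let p' : G.Walk r q := Walk.cons hra (p.concat hqb.symm)
  let W : G.Walk q q := Walk.cons hrq.symm p'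
  have hW : W.IsCycle := by
    rw [Walk.cons_isCycle_iff]
    refine ⟨?_, ?_⟩
    · rw [Walk.cons_isPath_iff]
      refine ⟨hpath.concat hqp hqb.symm, ?_⟩
      rw [Walk.support_concat]
      simp [hrp, hrq.ne]
    · simp only [p', Walk.edges_cons, Walk.edges_concat, List.mem_cons, List.concat_eq_append,
        List.mem_append, not_or, List.not_mem_nil, or_false]
      refine ⟨?_, ?_, ?_⟩
      · rw [Sym2.eq_iff]
        rintro (⟨rfl, -⟩ | ⟨rfl, -⟩)
        · exact hrq.ne rfl
        · exact hqp p.start_mem_support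
      · exact fun h => hrp (p.snd_mem_support_of_mem_edges h)
      · rw [Sym2.eq_iff]
        rintro (⟨rfl, -⟩ | ⟨-, rfl⟩)
        · exact hqp p.end_mem_support
        · exact hrp p.end_mem_support
  obtain ⟨e, he⟩ := hG q W hW (by simp [W, p']; omega)
  induction e using Sym2.ind with
  | _ x y =>
  rw [Walk.isChord_sym2Mk] at he
  obtain ⟨hadj, hedge, hx, hy⟩ := he
  have hsupp : ∀ z, z ∈ W.support ↔ z = q ∨ z = r ∨ z ∈ p.support := by
    intro z
    simp only [W, p', Walk.support_cons, Walk.support_concat, List.mem_cons, List.mem_append, List.not_mem_nil, or_false]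
    tauto
  have hedges : ∀ e, e ∈ W.edges ↔ e = s(q, r) ∨ e = s(r, a) ∨ e ∈ p.edges ∨ e = s(b, q) := by
    intro e
    simp only [W, p', Walk.edges_cons, Walk.edges_concat, List.mem_cons,
      List.concat_eq_append, List.mem_append, List.not_mem_nil, or_false]
  rw [hsupp] at hx hy
  rw [hedges] at hedge
  push Not at hedge
  obtain ⟨he1, he2, he3, he4⟩ := hedge
  -- a chord at `r`, at `q`, or between vertices of `p` would shorten `p`
  have hR : ∀ z ∈ p.support, G.Adj r z → z = a := by
    intro z hz hrz
    obtain ⟨A, B, rfl⟩ := Walk.mem_support_iff_exists_append.1 hz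
    have h := hmin z b B hrz hqb fun x hx => hp x (by simp [Walk.mem_support_append_iff, hx])
    rw [Walk.length_append] at h
    exact (Walk.eq_of_length_eq_zero (p := A) (by omega)).symm
  have hQ : ∀ z ∈ p.support, G.Adj q z → z = b := by
    intro z hz hqz
    obtain ⟨A, B, rfl⟩ := Walk.mem_support_iff_exists_append.1 hz
    have h := hmin a z A hra hqz fun x hx => hp x (by simp [Walk.mem_support_append_iff, hx])
    rw [Walk.length_append] at h
    exact Walk.eq_of_length_eq_zero (p := B) (by omega)
  have hP : ∀ (x y : V) (A : G.Walk a x) (B : G.Walk x y) (D : G.Walk y b), G.Adj x y →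
      p = A.append (B.append D) → s(x, y) ∉ p.edges → False := by
    intro x y A B D hxy hpe hne
    have h := exists_shorter_walk_of_adj A B D hxy fun h => hne (by
      rw [hpe]; simp [Walk.edges_append, h])
    have h2 := hmin a b (A.append (Walk.cons hxy D)) hra hqb fun z hz => hp z (by
      rw [hpe]
      simp only [Walk.mem_support_append_iff, Walk.support_cons, List.mem_cons] at hz ⊢
      rcases hz with hz | rfl | hz
      · exact Or.inl hz
      · exact Or.inl A.end_mem_support
      · exact Or.inr (Or.inr hz))
    rw [← hpe] at h
    omega
  rcases hx with rfl | rfl | hx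
  · rcases hy with rfl | rfl | hy
    · exact hadj.ne rfl
    · exact he1 rfl
    · exact he4 (by rw [hQ y hy hadj, Sym2.eq_swap])
  · rcases hy with rfl | rfl | hy
    · exact he1 Sym2.eq_swap
    · exact hadj.ne rfl
    · exact he2 (by rw [hR y hy hadj])
  · rcases hy with rfl | rfl | hy
    · exact he4 (by rw [hQ x hx hadj.symm])
    · exact he2 (by rw [hR x hx hadj.symm, Sym2.eq_swap])
    · obtain ⟨A, B, hAB⟩ := Walk.mem_support_iff_exists_append.1 hx
      have hy' := hy
      rw [hAB, Walk.mem_support_append_iff] at hy'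
      rcases hy' with hy' | hy'
      · obtain ⟨A₁, A₂, rfl⟩ := Walk.mem_support_iff_exists_append.1 hy'
        exact hP y x A₁ A₂ B hadj.symm (by rw [hAB, Walk.append_assoc])
          (by rwa [Sym2.eq_swap])
      · obtain ⟨B₁, B₂, rfl⟩ := Walk.mem_support_iff_exists_append.1 hy'
        exact hP x y A B₁ B₂ hadj hAB he3

theorem isPreconnectedSet_support {a b : V} (p : G.Walk a b) :
    G.IsPreconnectedSet {x | x ∈ p.support} := by
  have key : ∀ y ∈ p.support, ∃ w : G.Walk a y, ∀ x ∈ w.support, x ∈ p.support := by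
    intro y hy
    obtain ⟨A, B, rfl⟩ := Walk.mem_support_iff_exists_append.1 hy
    exact ⟨A, fun x hx => by simp [Walk.mem_support_append_iff, hx]⟩
  intro y hy z hz
  obtain ⟨wy, hwy⟩ := key y hy
  obtain ⟨wz, hwz⟩ := key z hz
  refine ⟨wy.reverse.append wz, fun x hx => ?_⟩
  rw [Walk.mem_support_append_iff, Walk.support_reverse, List.mem_reverse] at hx
  exact hx.elim (hwy x) (hwz x)

/-- In a chordal graph, every connected set `C` disjoint from a clique `Q` has a vertex adjacent to
all the vertices of `Q` that have a neighbour in `C`. Take `c` in `C` with the most neighbours in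
`Q`. If `q` is missed, then the end of a shortest walk in `C` from `c` to a neighbour of `q` has
more neighbours in `Q`. -/
theorem IsChordal.exists_adj_of_isClique [Finite V] (hG : G.IsChordal) {Q C : Set V}
    (hQ : G.IsClique Q) (hne : C.Nonempty) (hC : G.IsPreconnectedSet C) (hdisj : Disjoint Q C) :
    ∃ c ∈ C, ∀ q ∈ Q, (∃ b ∈ C, G.Adj q b) → G.Adj q c := by
  obtain ⟨c, hc, hmax⟩ := (Set.toFinite C).exists_maximalFor
    (fun c => {q ∈ Q | G.Adj q c}.ncard) C hne
  refine ⟨c, hc, fun q hq ⟨b, hb, hqb⟩ => ?_⟩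
  by_contra hqc
  let S : Set ℕ := {n | ∃ (b : V) (p : G.Walk c b), G.Adj q b ∧
    (∀ x ∈ p.support, x ∈ C) ∧ p.length = n}
  have hS : S.Nonempty := by
    obtain ⟨p, hp⟩ := hC c hc b hb
    exact ⟨_, b, p, hqb, hp, rfl⟩
  obtain ⟨d, p, hqd, hp, hlen⟩ := Nat.sInf_mem hS
  have hmin : ∀ (b' : V) (p' : G.Walk c b'), G.Adj q b' →
      (∀ x ∈ p'.support, x ∈ C) → p.length ≤ p'.length :=
    fun b' p' h2 h3 => hlen ▸ Nat.sInf_le ⟨b', p', h2, h3, rfl⟩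
  have honly : ∀ z ∈ p.support, G.Adj q z → z = d := by
    intro z hz hqz
    obtain ⟨A, B, rfl⟩ := Walk.mem_support_iff_exists_append.1 hz
    have h := hmin z A hqz fun x hx => hp x (by simp [Walk.mem_support_append_iff, hx])
    rw [Walk.length_append] at h
    exact Walk.eq_of_length_eq_zero (p := B) (by omega)
  have hdC : d ∈ C := hp d p.end_mem_support
  have hss : {q ∈ Q | G.Adj q c} ⊂ {q ∈ Q | G.Adj q d} := by
    refine (Set.ssubset_iff_of_subset ?_).2 ⟨q, ⟨hq, hqd⟩, fun h => hqc h.2⟩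
    rintro r ⟨hr, hrc⟩
    refine ⟨hr, ?_⟩
    have hrq : G.Adj r q := hQ hr hq (by rintro rfl; exact hqc hrc)
    obtain ⟨z, hz, hrz, hqz⟩ := hG.exists_common_neighbor hrq (C := {x | x ∈ p.support})
      (fun h => Set.disjoint_left.1 hdisj hr (hp r h))
      (fun h => Set.disjoint_left.1 hdisj hq (hp q h))
      (isPreconnectedSet_support p) p.start_mem_support hrc p.end_mem_support hqd
    rwa [← honly z hz hqz]
  have h1 := Set.ncard_lt_ncard hss (Set.toFinite _)
  exact absurd (hmax hdC h1.le) (not_le.2 h1)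

/-- The vertices that can be reached from `x` within `C`. -/
def reachableIn (G : SimpleGraph V) (C : Set V) (x : V) : Set V :=
  {y | ∃ p : G.Walk x y, ∀ z ∈ p.support, z ∈ C}

theorem mem_reachableIn_self {C : Set V} {x : V} (hx : x ∈ C) : x ∈ G.reachableIn C x :=
  ⟨.nil, by simpa⟩

theorem reachableIn_subset {C : Set V} {x : V} : G.reachableIn C x ⊆ C :=
  fun _ ⟨p, hp⟩ => hp _ p.end_mem_support

theorem mem_reachableIn_of_adj {C : Set V} {x y z : V} (hy : y ∈ G.reachableIn C x)
    (hz : z ∈ C) (h : G.Adj y z) : z ∈ G.reachableIn C x := by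
  obtain ⟨p, hp⟩ := hy
  refine ⟨p.concat h, fun v hv => ?_⟩
  rw [Walk.support_concat] at hv
  simp only [List.mem_append, List.mem_singleton] at hv
  rcases hv with hv | rfl
  · exact hp v hv
  · exact hz

theorem isPreconnectedSet_reachableIn (C : Set V) (x : V) :
    G.IsPreconnectedSet (G.reachableIn C x) := by
  have key : ∀ y ∈ G.reachableIn C x, ∃ p : G.Walk x y, ∀ z ∈ p.support,
      z ∈ G.reachableIn C x := by
    rintro y ⟨p, hp⟩
    refine ⟨p, fun z hz => ?_⟩
    obtain ⟨A, B, rfl⟩ := Walk.mem_support_iff_exists_append.1 hz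
    exact ⟨A, fun v hv => hp v (by simp [Walk.mem_support_append_iff, hv])⟩
  intro y hy z hz
  obtain ⟨wy, hwy⟩ := key y hy
  obtain ⟨wz, hwz⟩ := key z hz
  refine ⟨wy.reverse.append wz, fun v hv => ?_⟩
  rw [Walk.mem_support_append_iff, Walk.support_reverse, List.mem_reverse] at hv
  exact hv.elim (hwy v) (hwz v)

theorem reachableIn_eq {C : Set V} {x y : V} (h : y ∈ G.reachableIn C x) :
    G.reachableIn C y = G.reachableIn C x := by
  obtain ⟨p, hp⟩ := h
  ext z
  constructor
  · rintro ⟨w, hw⟩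
    refine ⟨p.append w, fun v hv => ?_⟩
    rw [Walk.mem_support_append_iff] at hv
    exact hv.elim (hp v) (hw v)
  · rintro ⟨w, hw⟩
    refine ⟨p.reverse.append w, fun v hv => ?_⟩
    rw [Walk.mem_support_append_iff, Walk.support_reverse, List.mem_reverse] at hv
    exact hv.elim (hp v) (hw v)

/-- A relative form of Dirac's theorem on simplicial vertices: a nonempty set `C` disjoint from a
clique `Q` contains a vertex that is simplicial in the graph induced on `C ∪ Q`. The induction
passes to a component of `C` and moves a vertex dominating its neighbours in `Q` from `C` to `Q`. -/
theorem IsChordal.exists_simplicial [Finite V] (hG : G.IsChordal) (n : ℕ) :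
    ∀ C Q : Set V, C.ncard = n → C.Nonempty → G.IsClique Q → Disjoint Q C →
      ∃ s ∈ C, G.IsClique {y ∈ C ∪ Q | G.Adj s y} := by
  induction n using Nat.strong_induction_on with
  | _ n ih =>
  intro C Q hn hne hQ hdisj
  obtain ⟨x, hx⟩ := hne
  set C₁ := G.reachableIn C x with hC₁
  have hC₁C : C₁ ⊆ C := reachableIn_subset
  obtain ⟨c, hc, hdom⟩ := hG.exists_adj_of_isClique hQ ⟨x, mem_reachableIn_self hx⟩
    (isPreconnectedSet_reachableIn C x) (hdisj.mono_right hC₁C)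
  by_cases hsing : C₁ ⊆ {c}
  · refine ⟨c, hC₁C hc, hQ.subset ?_⟩
    rintro y ⟨hy | hy, hcy⟩
    · exact absurd (hsing (mem_reachableIn_of_adj hc hy hcy)) hcy.ne'
    · exact hy
  · obtain ⟨y, hy, hyc⟩ := Set.not_subset.1 hsing
    let Q₁ : Set V := insert c {q ∈ Q | G.Adj q c}
    have hcard : (C₁ \ {c}).ncard < n := by
      rw [← hn]
      refine Set.ncard_lt_ncard ?_ (Set.toFinite _)
      exact (Set.ssubset_iff_of_subset (Set.sdiff_subset.trans hC₁C)).2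
        ⟨c, hC₁C hc, fun h => h.2 rfl⟩
    obtain ⟨s, hs, hcl⟩ := ih _ hcard (C₁ \ {c}) Q₁ rfl ⟨y, hy, hyc⟩ (by
        refine (hQ.subset (Set.sep_subset _ _)).insert fun q hq _ => hq.2.symm) (by
        rw [Set.disjoint_left]
        rintro q (rfl | hq) hq'
        · exact hq'.2 rfl
        · exact Set.disjoint_left.1 hdisj hq.1 (hC₁C hq'.1))
    refine ⟨s, hC₁C hs.1, hcl.subset ?_⟩
    rintro z ⟨hz | hz, hsz⟩
    · have hz₁ : z ∈ C₁ := mem_reachableIn_of_adj hs.1 hz hsz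
      by_cases hzc : z = c
      · exact ⟨Or.inr (Or.inl hzc), hsz⟩
      · exact ⟨Or.inl ⟨hz₁, hzc⟩, hsz⟩
    · exact ⟨Or.inr (Or.inr ⟨hz, hdom z hz ⟨s, hs.1, hsz.symm⟩⟩), hsz⟩

/-- The vertices in `U` are covered by as many cliques as some independent set in `U` has elements.
The cliques are the fibres of `f`; they are split off greedily at simplicial vertices. -/
theorem IsChordal.exists_cliqueCover [Finite V] (hG : G.IsChordal) (U : Finset V) :
    ∃ (S : Finset V) (f : V → V), S ⊆ U ∧ G.IsIndepSet (S : Set V) ∧ (∀ v ∈ U, f v ∈ S) ∧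
      ∀ v ∈ U, ∀ w ∈ U, f v = f w → v ≠ w → G.Adj v w := by
  classical
  induction U using Finset.strongInduction with
  | _ U ih =>
  rcases U.eq_empty_or_nonempty with rfl | hne
  · exact ⟨∅, id, by simp⟩
  obtain ⟨s, hs, hcl⟩ := hG.exists_simplicial _ (U : Set V) ∅ rfl hne (by simp) (by simp)
  rw [Set.union_empty] at hcl
  let U' := U.filter fun v => v ≠ s ∧ ¬ G.Adj s v
  have hU' : U' ⊂ U := by
    rw [Finset.filter_ssubset]
    exact ⟨s, hs, by simp⟩
  obtain ⟨S, f, hSU, hS, hf, hfcl⟩ := ih U' hU'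
  have hsS : ∀ v ∈ S, v ≠ s ∧ ¬ G.Adj s v := fun v hv => (Finset.mem_filter.1 (hSU hv)).2
  refine ⟨insert s S, fun v => if v = s ∨ G.Adj s v then s else f v, ?_, ?_, ?_, ?_⟩
  · exact Finset.insert_subset hs (hSU.trans hU'.subset)
  · rw [Finset.coe_insert, IsIndepSet, Set.pairwise_insert]
    exact ⟨hS, fun b hb _ => ⟨(hsS b hb).2, fun h => (hsS b hb).2 h.symm⟩⟩
  · intro v hv
    by_cases h : v = s ∨ G.Adj s v
    · simp [h]
    · simp only [if_neg h]
      exact Finset.mem_insert_of_mem (hf v (Finset.mem_filter.2 ⟨hv, not_or.1 h⟩))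
  · intro v hv w hw hvw hne
    beta_reduce at hvw
    by_cases h : v = s ∨ G.Adj s v <;> by_cases h' : w = s ∨ G.Adj s w
    · rcases h with rfl | h
      · exact h'.resolve_left hne.symm
      · rcases h' with rfl | h'
        · exact h.symm
        · exact hcl ⟨hv, h⟩ ⟨hw, h'⟩ hne
    · rw [if_pos h, if_neg h'] at hvw
      exact absurd hvw.symm (hsS _ (hf w (Finset.mem_filter.2 ⟨hw, not_or.1 h'⟩))).1
    · rw [if_neg h, if_pos h'] at hvw
      exact absurd hvw (hsS _ (hf v (Finset.mem_filter.2 ⟨hv, not_or.1 h⟩))).1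
    · rw [if_neg h, if_neg h'] at hvw
      exact hfcl v (Finset.mem_filter.2 ⟨hv, not_or.1 h⟩) w
        (Finset.mem_filter.2 ⟨hw, not_or.1 h'⟩) hvw hne

/-- In a chordal graph, a clique that meets every maximal independent set has a vertex without
neighbours outside the clique: otherwise choose in each component of the complement a vertex
adjacent to all vertices of the clique that have a neighbour in the component; these vertices form
an independent set dominating the clique. -/
theorem IsChordal.exists_forall_adj_mem [Finite V] (hG : G.IsChordal) {Q : Set V}
    (hQ : G.IsClique Q) (hmeet : ∀ I, Maximal G.IsIndepSet I → (I ∩ Q).Nonempty) :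
    ∃ q ∈ Q, ∀ w, G.Adj q w → w ∈ Q := by
  classical
  by_contra! hout
  have hex : ∀ C : Set V, ∃ c, C.Nonempty → G.IsPreconnectedSet C → Disjoint Q C →
      c ∈ C ∧ ∀ q ∈ Q, (∃ b ∈ C, G.Adj q b) → G.Adj q c := by
    intro C
    by_cases h : C.Nonempty ∧ G.IsPreconnectedSet C ∧ Disjoint Q C
    · obtain ⟨c, hc⟩ := hG.exists_adj_of_isClique hQ h.1 h.2.1 h.2.2
      exact ⟨c, fun _ _ _ => hc⟩
    · by_cases hV : Nonempty V
      · exact ⟨hV.some, fun h1 h2 h3 => absurd ⟨h1, h2, h3⟩ h⟩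
      · obtain ⟨I, -, hI⟩ := (Set.toFinite {I : Set V | G.IsIndepSet I}).exists_le_maximal
          (a := ∅) (by simp)
        exact absurd ⟨(hmeet I hI).some⟩ hV
  choose g hg using hex
  have hg' : ∀ x ∈ Qᶜ, g (G.reachableIn Qᶜ x) ∈ G.reachableIn Qᶜ x ∧
      ∀ q ∈ Q, (∃ b ∈ G.reachableIn Qᶜ x, G.Adj q b) → G.Adj q (g (G.reachableIn Qᶜ x)) :=
    fun x hx => hg _ ⟨x, mem_reachableIn_self hx⟩ (isPreconnectedSet_reachableIn _ _)
      (disjoint_compl_right.mono_right reachableIn_subset)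
  let D : Set V := (fun x => g (G.reachableIn Qᶜ x)) '' Qᶜ
  have hD : G.IsIndepSet D := by
    rintro _ ⟨x, hx, rfl⟩ _ ⟨y, hy, rfl⟩ hne hadj
    refine hne ?_
    have h := mem_reachableIn_of_adj (hg' x hx).1 (reachableIn_subset (hg' y hy).1) hadj
    have h1 := reachableIn_eq h
    have h2 := reachableIn_eq (hg' y hy).1
    simp only
    rw [← h1, h2]
  obtain ⟨I, hDI, hI⟩ := (Set.toFinite {I : Set V | G.IsIndepSet I}).exists_le_maximal hD
  obtain ⟨q, hqI, hqQ⟩ := hmeet I hI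
  obtain ⟨x, hqx, hx⟩ := hout q hqQ
  have hadj := (hg' x hx).2 q hqQ ⟨x, mem_reachableIn_self hx, hqx⟩
  exact hI.prop hqI (hDI ⟨x, hx, rfl⟩) hadj.ne hadj

theorem IsFreeVertex.mem_of_adj [Finite V] {F : Set V} {a w : V} (ha : G.IsFreeVertex F a)
    (h : G.Adj a w) : w ∈ F := by
  have hcl : G.IsClique {a, w} := by
    rw [isClique_pair]
    exact fun _ => h
  obtain ⟨H, hle, hH⟩ := (Set.toFinite {H : Set V | G.IsClique H}).exists_le_maximal hcl
  rw [← ha.2 H hH (hle (by simp))]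
  exact hle (by simp)

/-- Well-coveredness: the independent sets are not larger than the maximal independent sets. -/
def IsWellCovered (G : SimpleGraph V) : Prop :=
  ∀ s t : Finset V, Maximal G.IsIndepSet (s : Set V) → G.IsIndepSet (t : Set V) → t.card ≤ s.card

/-- Distinct facets with free vertices are disjoint: in a maximal independent set, a common vertex
could be exchanged for the two free vertices. -/
theorem IsWellCovered.eq_of_mem_of_mem [Finite V] (hG : G.IsWellCovered) {F₁ F₂ : Set V}
    (h₁ : F₁ ∈ G.freeFacets) (h₂ : F₂ ∈ G.freeFacets) {v : V} (hv₁ : v ∈ F₁) (hv₂ : v ∈ F₂) :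
    F₁ = F₂ := by
  classical
  obtain ⟨hF₁, a, ha⟩ := h₁
  obtain ⟨hF₂, b, hb⟩ := h₂
  by_contra hne
  have hav : a ≠ v := by
    rintro rfl
    exact hne (ha.2 F₂ hF₂ hv₂).symm
  have hbv : b ≠ v := by
    rintro rfl
    exact hne (hb.2 F₁ hF₁ hv₁)
  have hb₁ : b ∉ F₁ := fun h => hne (hb.2 F₁ hF₁ h)
  have hab : a ≠ b := by
    rintro rfl
    exact hb₁ ha.1
  have hnadj : ¬ G.Adj a b := fun h => hb₁ (ha.mem_of_adj h)
  have hadj_a : G.Adj a v := hF₁.prop ha.1 hv₁ hav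
  have hadj_b : G.Adj b v := hF₂.prop hb.1 hv₂ hbv
  obtain ⟨I, hle, hI⟩ := (Set.toFinite {I : Set V | G.IsIndepSet I}).exists_le_maximal
    (a := {v}) (by simp [IsIndepSet])
  have hvI : v ∈ I := hle rfl
  let s : Finset V := (Set.toFinite I).toFinset
  have hs : (s : Set V) = I := by simp [s]
  have haI : ∀ x ∈ I, x ≠ v → ¬ G.Adj a x := fun x hx hxv h =>
    hI.prop hx hvI hxv (hF₁.prop (ha.mem_of_adj h) hv₁ hxv)
  have hbI : ∀ x ∈ I, x ≠ v → ¬ G.Adj b x := fun x hx hxv h =>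
    hI.prop hx hvI hxv (hF₂.prop (hb.mem_of_adj h) hv₂ hxv)
  have haI' : a ∉ I := fun h => hI.prop h hvI hav hadj_a
  have hbI' : b ∉ I := fun h => hI.prop h hvI hbv hadj_b
  let t : Finset V := insert a (insert b (s.erase v))
  have ht : G.IsIndepSet (t : Set V) := by
    simp only [t, Finset.coe_insert, Finset.coe_erase, hs, IsIndepSet, Set.pairwise_insert]
    refine ⟨⟨Set.Pairwise.mono Set.sdiff_subset hI.prop, fun x hx _ =>
      ⟨hbI x hx.1 hx.2, fun h => hbI x hx.1 hx.2 h.symm⟩⟩, ?_⟩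
    rintro x (rfl | hx) _
    · exact ⟨hnadj, fun h => hnadj h.symm⟩
    · exact ⟨haI x hx.1 hx.2, fun h => haI x hx.1 hx.2 h.symm⟩
  have hcard := hG s t (by rwa [hs]) ht
  have h1 : b ∉ s.erase v := fun h => hbI' (by simpa [s] using Finset.mem_of_mem_erase h)
  have h2 : a ∉ insert b (s.erase v) := by
    rw [Finset.mem_insert, not_or]
    exact ⟨hab, fun h => haI' (by simpa [s] using Finset.mem_of_mem_erase h)⟩
  rw [Finset.card_insert_of_notMem h2, Finset.card_insert_of_notMem h1] at hcard
  have := Finset.card_erase_add_one (s := s) (a := v) (by simpa [s] using hvI)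
  omega

theorem IsChordal.exists_mem_freeFacets [Finite V] (hG : G.IsChordal) (hwc : G.IsWellCovered)
    (v : V) : ∃ F ∈ G.freeFacets, v ∈ F := by
  classical
  have := Fintype.ofFinite V
  obtain ⟨S, f, -, hS, hf, hfcl⟩ := hG.exists_cliqueCover Finset.univ
  simp only [Finset.mem_univ, true_implies] at hf hfcl
  let Q : Set V := {w | f w = f v}
  have hQ : G.IsClique Q := fun x hx y hy hne => hfcl x y (hx.trans hy.symm) hne
  -- by counting, every maximal independent set meets every clique of the cover
  have hmeet : ∀ I, Maximal G.IsIndepSet I → (I ∩ Q).Nonempty := by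
    intro I hI
    let s : Finset V := (Set.toFinite I).toFinset
    have hs : (s : Set V) = I := by simp [s]
    have hcard := hwc s S (by rwa [hs]) hS
    have hinj : Set.InjOn f (s : Set V) := by
      intro x hx y hy hxy
      by_contra hne
      rw [hs] at hx hy
      exact hI.prop hx hy hne (hfcl x y hxy hne)
    have himg : s.image f = S := by
      refine Finset.eq_of_subset_of_card_le ?_ ?_
      · intro y hy
        obtain ⟨x, -, rfl⟩ := Finset.mem_image.1 hy
        exact hf x
      · rwa [Finset.card_image_of_injOn hinj]
    obtain ⟨x, hx, hxv⟩ := Finset.mem_image.1 (himg ▸ hf v)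
    exact ⟨x, by simpa [s] using hx, hxv⟩
  obtain ⟨q, hq, hqadj⟩ := hG.exists_forall_adj_mem hQ hmeet
  have hsub : ∀ H, G.IsClique H → q ∈ H → H ⊆ Q := by
    intro H hH hqH x hx
    by_cases hxq : q = x
    · exact hxq ▸ hq
    · exact hqadj x (hH hqH hx hxq)
  refine ⟨Q, ⟨⟨hQ, fun H hH hle => hsub H hH (hle hq)⟩, q, hq, fun H hH hqH => ?_⟩, rfl⟩
  exact hH.eq_of_subset hQ (hsub H hH.prop hqH)

end SimpleGraph

end

/-! ### From free facets to the type; disjoint unions of edges -/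

section

namespace SimpleGraph

variable {V : Type u} {G : SimpleGraph V}

/-- The partition of the vertices into the facets with a free vertex, if each vertex lies in exactly
one of them. -/
noncomputable def FreeCliquePartition.ofFreeFacets [Finite V]
    (hex : ∀ v, ∃ F ∈ G.freeFacets, v ∈ F)
    (huniq : ∀ F₁ ∈ G.freeFacets, ∀ F₂ ∈ G.freeFacets, ∀ v, v ∈ F₁ → v ∈ F₂ → F₁ = F₂)
    (c : G.freeFacets → V) (hc : ∀ F : G.freeFacets, G.IsFreeVertex F (c F)) :
    G.FreeCliquePartition G.freeFacets where
  part v := ⟨(hex v).choose, (hex v).choose_spec.1⟩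
  free := c
  part_free F := Subtype.ext (huniq _ (hex _).choose_spec.1 _ F.2 _ (hex _).choose_spec.2 (hc F).1)
  adj_of_part_eq {v w} hne h := by
    have h : (hex v).choose = (hex w).choose := congrArg Subtype.val h
    refine (hex v).choose_spec.1.1.prop (hex v).choose_spec.2 ?_ hne
    rw [h]
    exact (hex w).choose_spec.2
  part_eq_of_adj {F w} h := Subtype.ext
    (huniq _ (hex w).choose_spec.1 _ F.2 w (hex w).choose_spec.2 ((hc F).mem_of_adj h))

theorem numMaximalIndepSets_eq_one_iff {W : Type*} [Finite W] (H : SimpleGraph W) :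
    H.numMaximalIndepSets = 1 ↔ ∀ u w, ¬ H.Adj u w := by
  rw [numMaximalIndepSets, Set.ncard_eq_one]
  constructor
  · rintro ⟨s, hs⟩ u w huw
    have key : ∀ x, x ∈ s := by
      intro x
      obtain ⟨I, hle, hI⟩ := (Set.toFinite {I : Set W | H.IsIndepSet I}).exists_le_maximal
        (a := {x}) (by simp [IsIndepSet])
      have : I ∈ ({s} : Set (Set W)) := hs ▸ hI
      rw [← Set.mem_singleton_iff.1 this]
      exact hle rfl
    have hmax : Maximal H.IsIndepSet s := by
      have : s ∈ {s | Maximal H.IsIndepSet s} := by rw [hs]; rfl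
      exact this
    exact hmax.prop (key u) (key w) huw.ne huw
  · intro h
    have huniv : H.IsIndepSet Set.univ := fun u _ w _ _ => h u w
    refine ⟨Set.univ, Set.ext fun s => ⟨fun hs => ?_, ?_⟩⟩
    · exact hs.eq_of_subset huniv (Set.subset_univ s)
    · rintro rfl
      exact ⟨huniv, fun _ _ _ => Set.subset_univ _⟩

theorem FreeCliquePartition.isDisjointUnionOfEdges {ι : Type*} (P : G.FreeCliquePartition ι)
    (hisolated : ∀ v, ¬ G.IsIsolated v)
    (h : ∀ u w, ¬ (G.induce (Set.range P.free)ᶜ).Adj u w) : G.IsDisjointUnionOfEdges := by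
  have hrest : ∀ u w, G.Adj u w → u ∉ Set.range P.free → w ∉ Set.range P.free → False :=
    fun u w huw hu hw => h ⟨u, hu⟩ ⟨w, hw⟩ huw
  have hfree : ∀ i w, G.Adj (P.free i) w → w ∉ Set.range P.free := by
    rintro i _ hadj ⟨j, rfl⟩
    have := P.part_eq_of_adj hadj
    rw [P.part_free] at this
    exact hadj.ne (this ▸ rfl)
  have huniq : ∀ v w w', G.Adj v w → G.Adj v w' → w = w' := by
    intro v w w' hw hw'
    by_cases hv : v ∈ Set.range P.free
    · obtain ⟨i, rfl⟩ := hv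
      by_contra hne
      exact hrest w w' (P.adj_of_part_eq hne ((P.part_eq_of_adj hw).trans
        (P.part_eq_of_adj hw').symm)) (hfree i w hw) (hfree i w' hw')
    · obtain ⟨i, rfl⟩ := not_not.1 fun h => hrest v w hw hv h
      obtain ⟨j, rfl⟩ := not_not.1 fun h => hrest v w' hw' hv h
      rw [← P.part_eq_of_adj hw.symm, ← P.part_eq_of_adj hw'.symm]
  intro v
  obtain ⟨w, hw⟩ : ∃ w, G.Adj v w := by
    by_contra! h0
    exact hisolated v fun w => h0 w
  refine ⟨s(v, w), ⟨hw, by simp⟩, ?_⟩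
  rintro e ⟨he, hve⟩
  obtain ⟨w', rfl⟩ := hve
  rw [huniq v w w' hw he]

theorem IsDisjointUnionOfEdges.exists_forall_adj_iff (hG : G.IsDisjointUnionOfEdges) (v : V) :
    ∃ w, ∀ x, G.Adj v x ↔ x = w := by
  obtain ⟨e, ⟨he, w, rfl⟩, huniq⟩ := hG v
  refine ⟨w, fun x => ⟨fun hx => ?_, ?_⟩⟩
  · have := huniq s(v, x) ⟨hx, by simp⟩
    exact Sym2.congr_right.1 this
  · rintro rfl
    exact he

theorem isCliqueFacet_iff_eq_pair {v w : V} (hw : ∀ x, G.Adj v x ↔ x = w) {F : Set V}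
    (hv : v ∈ F) : G.IsCliqueFacet F ↔ F = {v, w} := by
  have hpair : G.IsClique {v, w} := by
    rw [isClique_pair]
    exact fun _ => (hw w).2 rfl
  have hle : ∀ H, G.IsClique H → v ∈ H → H ⊆ {v, w} := by
    intro H hH hvH x hx
    by_cases hxv : v = x
    · exact Or.inl hxv.symm
    · exact Or.inr ((hw x).1 (hH hvH hx hxv))
  constructor
  · intro hF
    exact hF.eq_of_subset hpair (hle F hF.prop hv)
  · rintro rfl
    exact ⟨hpair, fun H hH hle' => hle H hH (hle' hv)⟩

theorem IsDisjointUnionOfEdges.exists_mem_freeFacets (hG : G.IsDisjointUnionOfEdges) (v : V) :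
    ∃ F ∈ G.freeFacets, v ∈ F := by
  obtain ⟨w, hw⟩ := hG.exists_forall_adj_iff v
  have hv : v ∈ ({v, w} : Set V) := Or.inl rfl
  exact ⟨{v, w}, ⟨(isCliqueFacet_iff_eq_pair hw hv).2 rfl, v, hv,
    fun H hH hvH => (isCliqueFacet_iff_eq_pair hw hvH).1 hH⟩, hv⟩

theorem IsDisjointUnionOfEdges.eq_of_mem_of_mem (hG : G.IsDisjointUnionOfEdges) {F₁ F₂ : Set V}
    (h₁ : G.IsCliqueFacet F₁) (h₂ : G.IsCliqueFacet F₂) {v : V} (hv₁ : v ∈ F₁) (hv₂ : v ∈ F₂) :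
    F₁ = F₂ := by
  obtain ⟨w, hw⟩ := hG.exists_forall_adj_iff v
  rw [(isCliqueFacet_iff_eq_pair hw hv₁).1 h₁, (isCliqueFacet_iff_eq_pair hw hv₂).1 h₂]

theorem IsDisjointUnionOfEdges.not_adj_induce (hG : G.IsDisjointUnionOfEdges)
    (c : G.freeFacets → V) (hc : ∀ F : G.freeFacets, G.IsFreeVertex F (c F))
    (u w : ((Set.range c)ᶜ : Set V)) : ¬ (G.induce (Set.range c)ᶜ).Adj u w := by
  intro huw
  obtain ⟨F, hF, hu⟩ := hG.exists_mem_freeFacets u.1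
  obtain ⟨w', hw'⟩ := hG.exists_forall_adj_iff u.1
  have hFeq := (isCliqueFacet_iff_eq_pair hw' hu).1 hF.1
  have hww : w.1 = w' := (hw' _).1 huw
  have hcF : c ⟨F, hF⟩ ∈ ({u.1, w'} : Set V) := hFeq ▸ (hc ⟨F, hF⟩).1
  rcases hcF with h | h
  · exact u.2 ⟨_, h⟩
  · exact w.2 ⟨_, h.trans hww.symm⟩

theorem IsChordal.isOfTypeOver [Finite V] (hG : G.IsChordal) (c : G.freeFacets → V)
    (hc : ∀ F : G.freeFacets, G.IsFreeVertex F (c F)) (K : Type w) [Field K]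
    (hCM : IsCohenMacaulayOver K G) :
    IsOfTypeOver K G (G.induce (Set.range c)ᶜ).numMaximalIndepSets := by
  classical
  have := Fintype.ofFinite V
  have := Fintype.ofFinite G.freeFacets
  have hwc : G.IsWellCovered := fun _ _ hs ht => hCM.card_le_card K hs ht
  exact ⟨hCM, (FreeCliquePartition.ofFreeFacets (hG.exists_mem_freeFacets hwc)
    (fun _ h₁ _ h₂ _ => hwc.eq_of_mem_of_mem h₁ h₂) c hc).cohenMacaulayType_eq K⟩

theorem IsChordal.isGorensteinOver_iff [Finite V] (hG : G.IsChordal)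
    (hisolated : ∀ v, ¬ G.IsIsolated v) (c : G.freeFacets → V)
    (hc : ∀ F : G.freeFacets, G.IsFreeVertex F (c F)) (K : Type w) [Field K] :
    IsGorensteinOver K G ↔ G.IsDisjointUnionOfEdges := by
  classical
  have := Fintype.ofFinite V
  have := Fintype.ofFinite G.freeFacets
  constructor
  · rintro ⟨hCM, htype⟩
    have hwc : G.IsWellCovered := fun _ _ hs ht => hCM.card_le_card K hs ht
    rw [(hG.isOfTypeOver c hc K hCM).2, Nat.cast_inj, numMaximalIndepSets_eq_one_iff] at htype
    exact (FreeCliquePartition.ofFreeFacets (hG.exists_mem_freeFacets hwc)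
      (fun _ h₁ _ h₂ _ => hwc.eq_of_mem_of_mem h₁ h₂) c hc).isDisjointUnionOfEdges hisolated htype
  · intro hE
    have hCM : IsCohenMacaulayOver K G :=
      (FreeCliquePartition.ofFreeFacets hE.exists_mem_freeFacets
        (fun _ h₁ _ h₂ _ => hE.eq_of_mem_of_mem h₁.1 h₂.1) c hc).isCohenMacaulayOver K
    have h := hG.isOfTypeOver c hc K hCM
    rwa [(numMaximalIndepSets_eq_one_iff _).2 (hE.not_adj_induce c hc)] at h

end SimpleGraph

end

theorem corollary2p2 {V : Type u} [Finite V] (G : SimpleGraph V)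
    (hchordal : G.IsChordal) (hisolated : ∀ v, ¬ G.IsIsolated v)
    (c : G.freeFacets → V) (hc : ∀ F : G.freeFacets, G.IsFreeVertex F (c F)) :
    -- part (a): over each field over which the graph is Cohen-Macaulay, and for the graph itself
    ((∀ (K : Type w) [Field K], SimpleGraph.IsCohenMacaulayOver K G →
        SimpleGraph.IsOfTypeOver K G (G.induce (Set.range c)ᶜ).numMaximalIndepSets) ∧
      (SimpleGraph.IsCohenMacaulay.{u, w} G →
        SimpleGraph.IsOfType.{u, w} G (G.induce (Set.range c)ᶜ).numMaximalIndepSets)) ∧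
    -- part (b): over each field, and for the graph itself
    ((∀ (K : Type w) [Field K],
        SimpleGraph.IsGorensteinOver K G ↔ G.IsDisjointUnionOfEdges) ∧
      (SimpleGraph.IsGorenstein.{u, w} G ↔ G.IsDisjointUnionOfEdges)) := by
  have ha : ∀ (K : Type w) [Field K], SimpleGraph.IsCohenMacaulayOver K G →
      SimpleGraph.IsOfTypeOver K G (G.induce (Set.range c)ᶜ).numMaximalIndepSets :=
    fun K _ hCM => hchordal.isOfTypeOver c hc K hCM
  have hb : ∀ (K : Type w) [Field K],
      SimpleGraph.IsGorensteinOver K G ↔ G.IsDisjointUnionOfEdges :=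
    fun K _ => hchordal.isGorensteinOver_iff hisolated c hc K
  exact ⟨⟨ha, fun hCM K _ => ha K (hCM K)⟩, hb,
    fun hGor => (hb (ULift.{w} ℚ)).1 (hGor _), fun hE K _ => (hb K).2 hE⟩
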